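/- Setting. For an abelian category $\mathcal A$ let $\mathcal K(\mathcal A),\mathcal K^+(\mathcal A),\mathcal K^-(\mathcal A),\mathcal K^b(\mathcal A)$ be the homotopy categories of unbounded, bounded below, bounded above and bounded complexes, and $\mathcal D(\mathcal A),\mathcal D^+(\mathcal A),\mathcal D^-(\mathcal A),\mathcal D^b(\mathcal A)$ the associated derived categories; $*$ and $\dagger$ each denote one of these four types. Let $R$ be an arbitrary ring, $\mathcal A=R\text{-Mod}$, let $\mathcal B$ be an abelian category, and let $(\Phi,\Psi)$ be a right adjoint pair of contravariant functors $\Phi:\mathcal A\to\mathcal B$, $\Psi:\mathcal B\to\mathcal A$, i.e. $\operatorname{Hom}_{\mathcal A}(A,\Psi B)\cong\operatorname{Hom}_{\mathcal B}(B,\Phi A)$ naturally, with unit $\eta_A:A\to\Psi\Phi A$. Assume that, extended termwise, $\Phi$ maps $\mathcal K^*(\mathcal A)$ to $\mathcal K^\dagger(\mathcal B)$ and $\Psi$ maps $\mathcal K^\dagger(\mathcal B)$ to $\mathcal K^*(\mathcal A)$, and that there are triangulated subcategories $\mathcal P\subseteq\mathcal K^*(\mathcal A)$ and $\mathcal Q\subseteq\mathcal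 K^\dagger(\mathcal B)$ such that every object $X$ of $\mathcal K^*(\mathcal A)$ (resp. of $\mathcal K^\dagger(\mathcal B)$) admits a quasi-isomorphism $P\to X$ with $P\in\mathcal P$ (resp. $P\in\mathcal Q$), and such that $\Phi$ (resp. $\Psi$) maps exact complexes in $\mathcal P$ (resp. $\mathcal Q$) to exact complexes. Then the total right derived functors $\mathbf R^*\Phi:\mathcal D^*(\mathcal A)\to\mathcal D^\dagger(\mathcal B)$ and $\mathbf R^\dagger\Psi:\mathcal D^\dagger(\mathcal B)\to\mathcal D^*(\mathcal A)$ exist and are computed by $\mathbf R^*\Phi X=\Phi P$ for $P\in\mathcal P$ quasi-isomorphic to $X$, and similarly for $\Psi$ with $\mathcal Q$; they form a right adjoint pair whose unit $\hat\eta_X:X\to\mathbf R^\dagger\Psi\,\mathbf R^*\Phi X$ is the one induced by $\eta$. Definitions. Objects are regarded as complexes concentrated in degree $0$. * An object $A$ of $\mathcal A$ is *$\mathcal D$-reflexive* if $\hat\eta_A$ is an isomorphism in $\mathcal D^*(\mathcal A)$. * $\Phi$ has *cohomological dimension $\le n$* if $H^i(\mathbf R^*\Phi A)=0$ for all $A\in\mathcal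 A$ and all $i\in\mathbb Z$ with $|i|>n$. * $A\in\mathcal A$ is *$\Phi$-acyclic* if $H^i(\mathbf R^*\Phi A)=0$ for all $i\ne0$; $\Psi$-acyclic objects of $\mathcal B$ are defined in the same way with $\mathbf R^\dagger\Psi$. * $\mathcal G_{\Phi\Psi}$ is the class of those $A\in\mathcal A$ such that $A$ is $\Phi$-acyclic, $\Phi A$ is $\Psi$-acyclic, and $\eta_A$ is an isomorphism. * A module $M$ has *$\mathcal G_{\Phi\Psi}$-dimension $\le n$* if there is an exact sequence $\cdots\to G_1\to G_0\to M\to0$ in which every $G_i$ is in $\mathcal G_{\Phi\Psi}$ or zero, and $G_i=0$ for $i>n$. * $FP_n$ is the class of modules $M$ for which there is an exact sequence $P_{n-1}\to\cdots\to P_1\to P_0\to M\to0$ with all $P_i$ finitely generated projective; $FP_0$ is the class of all modules. Theorem. Let $n\ge0$ be an integer. Assume that the left module ${}_RR$ is $\mathcal D$-reflexive and that $\Phi$ has cohomological dimension $\le n$. Then a module $M\in FP_n$ is $\mathcal D$-reflexive if and only if its $\mathcal G_{\Phi\Psi}$-dimension is $\le n$. -/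

import Mathlib

set_option linter.unusedSectionVars false

open CategoryTheory Limits Opposite Pretriangulated ZeroObject

namespace DerivedPair

section Generic

variable {C : Type*} [Category* C] [HasZeroObject C] [HasShift C ℤ] [Preadditive C]
  [∀ n : ℤ, (shiftFunctor C n).Additive] [Pretriangulated C] [IsTriangulated C]
  (P B : ObjectProperty C) [P.IsTriangulated] [B.IsTriangulated] [B.IsClosedUnderIsomorphisms]

lemma trW_inf {X Y : C} (f : X ⟶ Y) (hX : P X) (hY : P Y) (hf : B.trW f) : (P ⊓ B).trW f := by
  obtain ⟨Z, hZ, a, b, hT⟩ := P.distinguished_cocone_triangle f hX hY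
  rw [ObjectProperty.trW_iff]
  exact ⟨Z, a, b, hT, hZ, (B.trW_iff_of_distinguished _ hT).1 hf⟩

lemma isLeftDerivabilityStructure
    (hres : ∀ X : C, ∃ (Y : C) (f : Y ⟶ X), P Y ∧ B.trW f) :
    (P.triangulatedLocalizerMorphism B).IsLeftDerivabilityStructure := by
  have h0 : P.IsVerdierLeftLocalizing B := by
    rw [ObjectProperty.isVerdierLeftLocalizing_iff]
    intro X Y s hY hs
    obtain ⟨Z, f, hZ, hf⟩ := hres X
    exact ⟨Z, f ≫ s, f, hZ, trW_inf P B _ hZ hY (B.trW.comp_mem _ _ hf hs), rfl⟩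
  let T := P.triangulatedLocalizerMorphism B
  have h1 : T.HasLeftResolutions := fun X => by
    obtain ⟨Z, f, hZ, hf⟩ := hres X
    exact ⟨LocalizerMorphism.LeftResolution.mk (Φ := T) (X₁ := (⟨Z, hZ⟩ : P.FullSubcategory)) f hf⟩
  have h2 : T.IsLocalizedEquivalence := by
    let F := T.localizedFunctor (B.inverseImage P.ι).trW.Q B.trW.Q
    have : (T.functor ⋙ B.trW.Q).EssSurj := T.essSurj_of_hasLeftResolutions B.trW.Q
    have e : T.functor ⋙ B.trW.Q ≅ (B.inverseImage P.ι).trW.Q ⋙ F :=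
      CatCommSq.iso T.functor _ _ F
    have : ((B.inverseImage P.ι).trW.Q ⋙ F).EssSurj := Functor.essSurj_of_iso e
    have : F.EssSurj := ⟨fun Y => ⟨_, ⟨((B.inverseImage P.ι).trW.Q ⋙ F).objObjPreimageIso Y⟩⟩⟩
    have : F.IsEquivalence := { }
    exact LocalizerMorphism.IsLocalizedEquivalence.mk' T (B.inverseImage P.ι).trW.Q B.trW.Q F
  have h3 : ∀ X, IsConnected (T.LeftResolution X) := fun X => by
    have : Nonempty (T.LeftResolution X) := h1 X
    refine zigzag_isConnected fun R R' => ?_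
    obtain ⟨φ, hφ⟩ := (MorphismProperty.LeftFraction.mk (W := B.trW) R.w R'.w
      R'.hw).exists_rightFraction
    obtain ⟨Z, f, hZ, hf⟩ := hres φ.X'
    let R'' : T.LeftResolution X :=
      LocalizerMorphism.LeftResolution.mk (Φ := T) (X₁ := (⟨Z, hZ⟩ : P.FullSubcategory))
        ((f ≫ φ.s) ≫ R.w) (B.trW.comp_mem _ _ (B.trW.comp_mem _ _ hf φ.hs) R.hw)
    have hc : (f ≫ φ.f) ≫ R'.w = (f ≫ φ.s) ≫ R.w := by
      have : φ.s ≫ R.w = φ.f ≫ R'.w := hφ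
      simp [this]
    let g : R'' ⟶ R := LocalizerMorphism.LeftResolution.Hom.mk (P.homMk (f ≫ φ.s)) rfl
    let g' : R'' ⟶ R' := LocalizerMorphism.LeftResolution.Hom.mk (P.homMk (f ≫ φ.f)) hc
    exact (Zigzag.of_inv g).trans (Zigzag.of_hom g')
  have h4 : T.arrow.HasLeftResolutions := fun g => by
    obtain ⟨Q, q, hQ, hq⟩ := hres g.right
    obtain ⟨φ, hφ⟩ := (MorphismProperty.LeftFraction.mk (W := B.trW) g.hom q
      hq).exists_rightFraction
    obtain ⟨Z, f, hZ, hf⟩ := hres φ.X'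
    have hφ' : φ.s ≫ g.hom = φ.f ≫ q := hφ
    refine ⟨LocalizerMorphism.LeftResolution.mk (Φ := T.arrow)
      (X₁ := Arrow.mk (P.homMk (f ≫ φ.f) : (⟨Z, hZ⟩ : P.FullSubcategory) ⟶ ⟨Q, hQ⟩))
      (Arrow.homMk (f ≫ φ.s) q ?_) ⟨B.trW.comp_mem _ _ hf φ.hs, hq⟩⟩
    change (f ≫ φ.s) ≫ g.hom = (f ≫ φ.f) ≫ q
    simp [hφ']
  exact LocalizerMorphism.IsLeftDerivabilityStructure.mk' T

end Generic

section Kan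

variable {C D H : Type*} [Category* C] [Category* D] [Category* H]

lemma isRightKanExtension_of_op {G : C ⥤ H} {L : C ⥤ D} (LF : D ⥤ H) (α : L ⋙ LF ⟶ G)
    (h : LF.op.IsLeftKanExtension (L := L.op) (F := G.op) (NatTrans.op α)) :
    LF.IsRightKanExtension α := by
  have hfac : ∀ (E : D ⥤ H) (γ : L ⋙ E ⟶ G), ∃ τ : E ⟶ LF, Functor.whiskerLeft L τ ≫ α = γ := by
    intro E γ
    refine ⟨NatTrans.removeOp (LF.op.descOfIsLeftKanExtension (L := L.op) (F := G.op)
      (NatTrans.op α) E.op (NatTrans.op γ)), ?_⟩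
    ext X
    exact congrArg Quiver.Hom.unop (LF.op.descOfIsLeftKanExtension_fac_app (L := L.op)
      (F := G.op) (NatTrans.op α) E.op (NatTrans.op γ) (op X))
  have huniq : ∀ (E : D ⥤ H) (τ τ' : E ⟶ LF),
      Functor.whiskerLeft L τ ≫ α = Functor.whiskerLeft L τ' ≫ α → τ = τ' := by
    intro E τ τ' hτ
    have : NatTrans.op τ = NatTrans.op τ' := by
      apply LF.op.hom_ext_of_isLeftKanExtension (L := L.op) (F := G.op) (NatTrans.op α)
      ext X
      exact congrArg Quiver.Hom.op (NatTrans.congr_app hτ X.unop)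
    exact congrArg NatTrans.removeOp this
  choose lift hlift using hfac
  refine ⟨⟨IsTerminal.ofUniqueHom
    (fun E => CostructuredArrow.homMk (lift E.left E.hom) (hlift _ _)) ?_⟩⟩
  intro E m
  apply CostructuredArrow.hom_ext
  exact huniq _ _ _ ((CostructuredArrow.w m).trans (hlift _ _).symm)

end Kan

section Criterion

variable {C : Type*} [Category* C] [HasZeroObject C] [HasShift C ℤ] [Preadditive C]
  [∀ n : ℤ, (shiftFunctor C n).Additive] [Pretriangulated C] [IsTriangulated C]
  (P B : ObjectProperty C) [P.IsTriangulated] [B.IsTriangulated] [B.IsClosedUnderIsomorphisms]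
  {D H : Type*} [Category* D] [Category* H]

lemma derives_op (F : Cᵒᵖ ⥤ H)
    (hF : ∀ ⦃X Y : C⦄ (f : X ⟶ Y), P X → P Y → B.trW f → IsIso (F.map f.op)) :
    (P.triangulatedLocalizerMorphism B).op.Derives F := fun X Y f hf =>
  hF f.unop.hom Y.unop.2 X.unop.2 ((P.triangulatedLocalizerMorphism B).map _ hf)

lemma hasRightDerivedFunctor_of_resolving
    (hres : ∀ X : C, ∃ (Y : C) (f : Y ⟶ X), P Y ∧ B.trW f)
    {W : MorphismProperty C} (hW : W = B.trW)
    (F : Cᵒᵖ ⥤ H)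
    (hF : ∀ ⦃X Y : C⦄ (f : X ⟶ Y), P X → P Y → W f → IsIso (F.map f.op)) :
    F.HasRightDerivedFunctor W.op := by
  subst hW
  have := isLeftDerivabilityStructure P B hres
  have := (derives_op P B F hF).hasPointwiseRightDerivedFunctor
  infer_instance

lemma isRightDerivedFunctor_iff_of_resolving
    (hres : ∀ X : C, ∃ (Y : C) (f : Y ⟶ X), P Y ∧ B.trW f)
    {W : MorphismProperty C} (hW : W = B.trW)
    (F : Cᵒᵖ ⥤ H)
    (hF : ∀ ⦃X Y : C⦄ (f : X ⟶ Y), P X → P Y → W f → IsIso (F.map f.op))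
    {L : Cᵒᵖ ⥤ D} [L.IsLocalization W.op] {RF : D ⥤ H} (α : F ⟶ L ⋙ RF) :
    RF.IsRightDerivedFunctor α W.op ↔ ∀ X : C, P X → IsIso (α.app (op X)) := by
  subst hW
  have := isLeftDerivabilityStructure P B hres
  rw [(derives_op P B F hF).isRightDerivedFunctor_iff_isIso]
  exact ⟨fun h X hX => h (op ⟨X, hX⟩), fun h X => h X.unop.1 X.unop.2⟩

lemma isLeftDerivedFunctor_of_resolving
    (hres : ∀ X : C, ∃ (Y : C) (f : Y ⟶ X), P Y ∧ B.trW f)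
    {W : MorphismProperty C} (hW : W = B.trW)
    (G : C ⥤ H)
    (hG : ∀ ⦃X Y : C⦄ (f : X ⟶ Y), P X → P Y → W f → IsIso (G.map f))
    {L : C ⥤ D} [L.IsLocalization W] {LG : D ⥤ H} (α : L ⋙ LG ⟶ G)
    (hα : ∀ X : C, P X → IsIso (α.app X)) :
    LG.IsLeftDerivedFunctor α W := by
  rw [Functor.isLeftDerivedFunctor_iff_isRightKanExtension]
  apply isRightKanExtension_of_op
  have h : LG.op.IsRightDerivedFunctor (L := L.op) (F := G.op) (NatTrans.op α) W.op := by
    refine (isRightDerivedFunctor_iff_of_resolving P B hres hW G.op ?_ _).2 ?_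
    · intro X Y f hX hY hf
      have := hG f hX hY hf
      exact inferInstanceAs (IsIso (G.map f).op)
    · intro X hX
      have := hα X hX
      exact inferInstanceAs (IsIso (α.app X).op)
  exact h.isLeftKanExtension

end Criterion

/-- The four types of complexes: unbounded, bounded below, bounded above, bounded. -/
inductive Boundedness
  | none | plus | minus | bounded

section Bounded

variable (s : Boundedness) {A : Type*} [Category* A] [Abelian A]

/-- The cochain complex `X` is of boundedness type `s`. -/
def Boundedness.Holds (X : CochainComplex A ℤ) : Prop :=
  match s with
  | .none => True
  | .plus => ∃ n : ℤ, X.IsStrictlyGE n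
  | .minus => ∃ n : ℤ, X.IsStrictlyLE n
  | .bounded => (∃ n : ℤ, X.IsStrictlyGE n) ∧ ∃ n : ℤ, X.IsStrictlyLE n

lemma exists_isStrictlyGE_mappingCone {X Y : CochainComplex A ℤ} (f : X ⟶ Y)
    (hX : ∃ n : ℤ, X.IsStrictlyGE n) (hY : ∃ n : ℤ, Y.IsStrictlyGE n) :
    ∃ n : ℤ, (CochainComplex.mappingCone f).IsStrictlyGE n := by
  obtain ⟨n, _⟩ := hX
  obtain ⟨m, _⟩ := hY
  exact ⟨min (n - 1) m, CochainComplex.isStrictlyGE_mappingCone f n m _ (by simp) (by simp)⟩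

lemma exists_isStrictlyLE_mappingCone {X Y : CochainComplex A ℤ} (f : X ⟶ Y)
    (hX : ∃ n : ℤ, X.IsStrictlyLE n) (hY : ∃ n : ℤ, Y.IsStrictlyLE n) :
    ∃ n : ℤ, (CochainComplex.mappingCone f).IsStrictlyLE n := by
  obtain ⟨n, _⟩ := hX
  obtain ⟨m, _⟩ := hY
  refine ⟨max n m, ?_⟩
  rw [CochainComplex.isStrictlyLE_iff]
  intro i hi
  rw [CochainComplex.mappingCone.isZero_X_iff]
  exact ⟨X.isZero_of_isStrictlyLE n _ (by grind), Y.isZero_of_isStrictlyLE m _ (by grind)⟩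

lemma Boundedness.Holds.mappingCone {s : Boundedness} {X Y : CochainComplex A ℤ} (f : X ⟶ Y)
    (hX : s.Holds X) (hY : s.Holds Y) : s.Holds (CochainComplex.mappingCone f) := by
  cases s with
  | none => trivial
  | plus => exact exists_isStrictlyGE_mappingCone f hX hY
  | minus => exact exists_isStrictlyLE_mappingCone f hX hY
  | bounded => exact ⟨exists_isStrictlyGE_mappingCone f hX.1 hY.1,
      exists_isStrictlyLE_mappingCone f hX.2 hY.2⟩

lemma Boundedness.Holds.shift {s : Boundedness} {X : CochainComplex A ℤ} (hX : s.Holds X) (a : ℤ) :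
    s.Holds (X⟦a⟧) := by
  have hGE : (∃ n : ℤ, X.IsStrictlyGE n) → ∃ n : ℤ, (X⟦a⟧).IsStrictlyGE n := fun ⟨n, _⟩ =>
    ⟨n - a, X.isStrictlyGE_shift n a (n - a) (by lia)⟩
  have hLE : (∃ n : ℤ, X.IsStrictlyLE n) → ∃ n : ℤ, (X⟦a⟧).IsStrictlyLE n := fun ⟨n, _⟩ =>
    ⟨n - a, X.isStrictlyLE_shift n a (n - a) (by lia)⟩
  cases s with
  | none => trivial
  | plus => exact hGE hX
  | minus => exact hLE hX
  | bounded => exact ⟨hGE hX.1, hLE hX.2⟩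

lemma Boundedness.holds_of_strictlyGE_LE (X : CochainComplex A ℤ) (n m : ℤ) [X.IsStrictlyGE n]
    [X.IsStrictlyLE m] : s.Holds X := by
  cases s with
  | none => trivial
  | plus => exact ⟨n, inferInstance⟩
  | minus => exact ⟨m, inferInstance⟩
  | bounded => exact ⟨⟨n, inferInstance⟩, ⟨m, inferInstance⟩⟩

end Bounded

section Bounded

variable (s : Boundedness) (A : Type*) [Category* A] [Abelian A]

/-- The objects of the homotopy category `K(A)` which lie in `K*(A)`. -/
def Boundedness.prop : ObjectProperty (HomotopyCategory A (ComplexShape.up ℤ)) :=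
  fun X => s.Holds X.as

instance : (s.prop A).ContainsZero where
  exists_zero := ⟨(HomotopyCategory.quotient _ _).obj 0, Functor.map_isZero _ (isZero_zero _),
    s.holds_of_strictlyGE_LE (0 : CochainComplex A ℤ) 0 0⟩

instance : (s.prop A).IsStableUnderShift ℤ where
  isStableUnderShiftBy a :=
    { le_shift X hX := by
        obtain ⟨X : CochainComplex _ _, rfl⟩ := X.quotient_obj_surjective
        rw [ObjectProperty.prop_shift_iff, HomotopyCategory.shift_quotient_obj]
        exact Boundedness.Holds.shift (s := s) (X := X) hX a }

instance : (s.prop A).IsTriangulatedClosed₃ where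
  ext₃' T hT h₁ h₂ := by
    obtain ⟨f : T.obj₁.as ⟶ T.obj₂.as, hf⟩ :=
      (HomotopyCategory.quotient _ _).map_surjective T.mor₁
    refine ⟨(HomotopyCategory.quotient _ _).obj (CochainComplex.mappingCone f),
      Boundedness.Holds.mappingCone f h₁ h₂,
      ⟨Triangle.π₃.mapIso (isoTriangleOfIso₁₂ T _ hT
        (HomotopyCategory.mappingCone_triangleh_distinguished f)
        (Iso.refl _) (Iso.refl _) ?_)⟩⟩
    exact (Category.comp_id _).trans (hf.symm.trans (Category.id_comp _).symm)

instance : (s.prop A).IsTriangulated where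
  toIsTriangulatedClosed₂ := .of_isTriangulatedClosed₃

/-- The homotopy category `K*(A)`: a full triangulated subcategory of `K(A)`. -/
abbrev HoCat := (s.prop A).FullSubcategory

/-- The class of quasi-isomorphisms of `K*(A)`. -/
def qis : MorphismProperty (HoCat s A) :=
  (HomotopyCategory.quasiIso A (ComplexShape.up ℤ)).inverseImage (s.prop A).ι

/-- The exact complexes in `K*(A)`. -/
def acyclic : ObjectProperty (HoCat s A) :=
  (HomotopyCategory.subcategoryAcyclic A).inverseImage (s.prop A).ι

instance : (acyclic s A).IsTriangulated := by unfold acyclic; infer_instance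
instance : (acyclic s A).IsClosedUnderIsomorphisms := by unfold acyclic; infer_instance

lemma qis_eq : qis s A = (acyclic s A).trW := by
  ext X Y f
  rw [acyclic, ObjectProperty.inverseImage_trW_iff,
    ← HomotopyCategory.quasiIso_eq_trW_subcategoryAcyclic]
  rfl

/-- The derived category `D*(A)`: the localization of `K*(A)` at the quasi-isomorphisms. -/
abbrev DerCat := (qis s A).Localization

/-- The localization functor from `K*(A)` to `D*(A)`. -/
abbrev toDer : HoCat s A ⥤ DerCat s A := (qis s A).Q

/-- An object, as a complex concentrated in degree `0`, in `K*(A)`. -/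
noncomputable def stalkK : A ⥤ HoCat s A :=
  (s.prop A).lift (HomotopyCategory.singleFunctor A 0) fun X =>
    s.holds_of_strictlyGE_LE ((CochainComplex.singleFunctor A 0).obj X) 0 0

/-- An object, as a complex concentrated in degree `0`, in `D*(A)`. -/
noncomputable def stalk : A ⥤ DerCat s A := stalkK s A ⋙ toDer s A

/-- The cohomology functor `H^i` on `D*(A)`. -/
noncomputable def cohomology (i : ℤ) : DerCat s A ⥤ A :=
  Localization.lift ((s.prop A).ι ⋙ HomotopyCategory.homologyFunctor A (ComplexShape.up ℤ) i)
    (W := qis s A) (fun _ _ f hf => by exact hf i) (toDer s A)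

end Bounded

section Contra

variable {A B : Type*} [Category* A] [Category* B] [Abelian A] [Abelian B]

/-- The termwise extension of a contravariant additive functor to cochain complexes:
`F(X)` has the object `F(X^{-i})` in degree `i`. -/
noncomputable def mapComplex (F : Aᵒᵖ ⥤ B) [F.Additive] :
    (CochainComplex A ℤ)ᵒᵖ ⥤ CochainComplex B ℤ :=
  (CochainComplex.opEquivalence A).functor ⋙ F.mapHomologicalComplex (ComplexShape.up ℤ)

/-- The extension of a contravariant additive functor to the homotopy categories. -/
noncomputable def mapK (F : Aᵒᵖ ⥤ B) [F.Additive] :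
    (HomotopyCategory A (ComplexShape.up ℤ))ᵒᵖ ⥤ HomotopyCategory B (ComplexShape.up ℤ) :=
  (CategoryTheory.Quotient.lift _
    ((mapComplex F).rightOp ⋙ (HomotopyCategory.quotient B (ComplexShape.up ℤ)).op) (by
      rintro X Y f g ⟨h⟩
      exact congrArg Quiver.Hom.op (HomotopyCategory.eq_of_homotopy _ _
        (F.mapHomotopy (CochainComplex.homotopyOp h)))) :
    HomotopyCategory A (ComplexShape.up ℤ) ⥤ (HomotopyCategory B (ComplexShape.up ℤ))ᵒᵖ).leftOp

lemma quasiIso_mapComplex (F : Aᵒᵖ ⥤ B) [F.Additive] {X Y : CochainComplex A ℤ} (f : X ⟶ Y)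
    (h : QuasiIso ((F.rightOp.mapHomologicalComplex (ComplexShape.up ℤ)).map f)) :
   QuasiIso ((mapComplex F).map f.op) := by
  rw [quasiIso_iff]
  intro i
  have h' := (quasiIso_iff _).1 h (-i)
  rw [quasiIsoAt_iff' _ (i-1) i (i+1) (by simp) (by simp)]
  rw [quasiIsoAt_iff' _ (-(i+1)) (-i) (-(i-1)) (by simp; lia) (by simp; lia)] at h'
  exact ShortComplex.quasiIso_unopMap
    ((HomologicalComplex.shortComplexFunctor' Bᵒᵖ (ComplexShape.up ℤ) (-(i+1)) (-i) (-(i-1))).map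
      ((F.rightOp.mapHomologicalComplex (ComplexShape.up ℤ)).map f))

lemma acyclic_rightOp (F : Aᵒᵖ ⥤ B) [F.Additive] {X : CochainComplex A ℤ}
    (h : ((mapComplex F).obj (op X)).Acyclic) :
    ((F.rightOp.mapHomologicalComplex (ComplexShape.up ℤ)).obj X).Acyclic := by
  intro i
  obtain ⟨i, rfl⟩ : ∃ j, i = - j := ⟨-i, by simp⟩
  have h' := h i
  rw [HomologicalComplex.exactAt_iff' _ (-(i+1)) (-i) (-(i-1)) (by simp; lia) (by simp; lia)]
  rw [HomologicalComplex.exactAt_iff' _ (i-1) i (i+1) (by simp) (by simp)] at h'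
  rw [← ShortComplex.exact_unop_iff]
  exact h'

end Contra

section Derived

variable {A B : Type*} [Category* A] [Category* B] [Abelian A] [Abelian B]

/-- The contravariant functor from `K*(A)` to `K†(B)` induced by `F`. -/
noncomputable def mapBounded (F : Aᵒᵖ ⥤ B) [F.Additive] {s t : Boundedness}
    (h : ∀ X, s.prop A X → t.prop B ((mapK F).obj (op X))) : (HoCat s A)ᵒᵖ ⥤ HoCat t B :=
  (t.prop B).lift ((s.prop A).ι.op ⋙ mapK F) fun X => h _ X.unop.2

/-- `P` is a triangulated subcategory of `K*(A)` such that every complex has a quasi-isomorphism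
from a complex of `P` (as `F` is contravariant, these are the resolutions that compute its right
derived functor), and `F` maps the exact complexes of `P` to exact complexes. -/
structure IsAdapted (F : Aᵒᵖ ⥤ B) [F.Additive] (s : Boundedness)
    (P : ObjectProperty (HoCat s A)) : Prop where
  isTriangulated : P.IsTriangulated
  exists_resolution : ∀ X : HoCat s A, ∃ (Y : HoCat s A) (f : Y ⟶ X), P Y ∧ qis s A f
  exact_obj : ∀ X : HoCat s A, P X → HomologicalComplex.Acyclic X.obj.as →
    ((mapComplex F).obj (op X.obj.as)).Acyclic

lemma quasiIso_mapK_of_isAdapted {F : Aᵒᵖ ⥤ B} [F.Additive] {s : Boundedness}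
    {P : ObjectProperty (HoCat s A)} (hP : IsAdapted F s P) {X Y : HoCat s A} (f : X ⟶ Y)
    (hX : P X) (hY : P Y) (hf : (acyclic s A).trW f) :
    HomotopyCategory.quasiIso B (ComplexShape.up ℤ) ((mapK F).map f.hom.op) := by
  have := hP.isTriangulated
  have h1 := trW_inf P _ f hX hY hf
  rw [ObjectProperty.trW_iff] at h1
  obtain ⟨Z, a, b, hT, hZ, hZ'⟩ := h1
  have h2 := (F.rightOp.mapHomotopyCategory (ComplexShape.up ℤ)).map_distinguished _
    ((s.prop A).ι.map_distinguished _ hT)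
  have h3 : (HomotopyCategory.subcategoryAcyclic Bᵒᵖ)
      ((F.rightOp.mapHomotopyCategory (ComplexShape.up ℤ)).obj Z.obj) := by
    refine (HomotopyCategory.quotient_obj_mem_subcategoryAcyclic_iff_acyclic
      ((F.rightOp.mapHomologicalComplex (ComplexShape.up ℤ)).obj Z.obj.as)).2 ?_
    refine acyclic_rightOp F (hP.exact_obj Z hZ ?_)
    exact (HomotopyCategory.quotient_obj_mem_subcategoryAcyclic_iff_acyclic Z.obj.as).1 hZ'
  have h4 := (ObjectProperty.trW_iff_of_distinguished _ _ h2).2 h3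
  rw [← HomotopyCategory.quasiIso_eq_trW_subcategoryAcyclic] at h4
  obtain ⟨g, hg⟩ := (HomotopyCategory.quotient A (ComplexShape.up ℤ)).map_surjective f.hom
  change HomotopyCategory.quasiIso Bᵒᵖ (ComplexShape.up ℤ)
    ((F.rightOp.mapHomotopyCategory (ComplexShape.up ℤ)).map f.hom) at h4
  rw [← hg] at h4 ⊢
  refine (HomotopyCategory.quotient_map_mem_quasiIso_iff _).2 ?_
  exact quasiIso_mapComplex F g ((HomotopyCategory.quotient_map_mem_quasiIso_iff _).1 h4)

lemma IsAdapted.exists_trW {F : Aᵒᵖ ⥤ B} [F.Additive] {s : Boundedness}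
    {P : ObjectProperty (HoCat s A)} (hP : IsAdapted F s P) (X : HoCat s A) :
    ∃ (Y : HoCat s A) (f : Y ⟶ X), P Y ∧ (acyclic s A).trW f := by
  simpa only [qis_eq] using hP.exists_resolution X

lemma IsAdapted.isIso_map {s : Boundedness} {F : Aᵒᵖ ⥤ B} [F.Additive]
    {P : ObjectProperty (HoCat s A)} (hP : IsAdapted F s P) {t : Boundedness}
    (h : ∀ X, s.prop A X → t.prop B ((mapK F).obj (op X))) {X Y : HoCat s A} (f : X ⟶ Y)
    (hX : P X) (hY : P Y) (hf : qis s A f) :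
    IsIso ((mapBounded F h ⋙ toDer t B).map f.op) := by
  refine Localization.inverts (toDer t B) (qis t B) ((mapBounded F h).map f.op) ?_
  exact quasiIso_mapK_of_isAdapted hP f hX hY (by rwa [← qis_eq])

lemma IsAdapted.hasRightDerivedFunctor {s : Boundedness} {F : Aᵒᵖ ⥤ B} [F.Additive]
    {P : ObjectProperty (HoCat s A)} (hP : IsAdapted F s P) {t : Boundedness}
    (h : ∀ X, s.prop A X → t.prop B ((mapK F).obj (op X))) :
    (mapBounded F h ⋙ toDer t B).HasRightDerivedFunctor (qis s A).op :=
  have := hP.isTriangulated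
  hasRightDerivedFunctor_of_resolving P (acyclic s A) (hP.exists_trW) (qis_eq s A) _
    fun _ _ f hX hY hf => hP.isIso_map h f hX hY hf

variable (F : Aᵒᵖ ⥤ B) [F.Additive] {s t : Boundedness}
    (h : ∀ X, s.prop A X → t.prop B ((mapK F).obj (op X)))
    {P : ObjectProperty (HoCat s A)} (hP : IsAdapted F s P)

/-- The total right derived functor of the contravariant functor `F`. -/
noncomputable def rightDerived : (DerCat s A)ᵒᵖ ⥤ DerCat t B :=
  have := hP.hasRightDerivedFunctor h
  (mapBounded F h ⋙ toDer t B).totalRightDerived (toDer s A).op (qis s A).op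

/-- The canonical morphism from `F` to its right derived functor. -/
noncomputable def rightDerivedUnit :
    mapBounded F h ⋙ toDer t B ⟶ (toDer s A).op ⋙ rightDerived F h hP :=
  have := hP.hasRightDerivedFunctor h
  (mapBounded F h ⋙ toDer t B).totalRightDerivedUnit (toDer s A).op (qis s A).op

instance : (rightDerived F h hP).IsRightDerivedFunctor (rightDerivedUnit F h hP)
    (qis s A).op := by
  have := hP.hasRightDerivedFunctor h
  dsimp only [rightDerived, rightDerivedUnit]
  infer_instance

lemma isIso_rightDerivedUnit_app (X : HoCat s A) (hX : P X) :
    IsIso ((rightDerivedUnit F h hP).app (op X)) := by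
  have := hP.isTriangulated
  exact (isRightDerivedFunctor_iff_of_resolving P (acyclic s A) (hP.exists_trW) (qis_eq s A) _
    (fun _ _ f hX hY hf => hP.isIso_map h f hX hY hf) (rightDerivedUnit F h hP)).1
    inferInstance X hX

end Derived

section Adj
universe v₁ u₁ v₂ u₂

/-- A right adjoint pair of contravariant functors between abelian categories: natural
bijections between `Hom(X, Ψ Y)` and `Hom(Y, Φ X)`. Both functors are then additive. -/
structure RightAdjointPair (A : Type u₁) [Category.{v₁} A] [Abelian A]
    (B : Type u₂) [Category.{v₂} B] [Abelian B] where
  Φ : Aᵒᵖ ⥤ B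
  Ψ : Bᵒᵖ ⥤ A
  adj : Φ.rightOp ⊣ Ψ

namespace RightAdjointPair
variable {A : Type u₁} [Category.{v₁} A] [Abelian A]
    {B : Type u₂} [Category.{v₂} B] [Abelian B] (p : RightAdjointPair A B)

instance : p.Ψ.Additive := by
  have := p.adj.isRightAdjoint
  have : PreservesLimitsOfSize.{0, 0} p.Ψ := p.adj.rightAdjoint_preservesLimits
  exact Functor.additive_of_preserves_binary_products _

instance : p.Φ.Additive := by
  have := p.adj.left_adjoint_additive
  exact ⟨fun {X Y f g} => congrArg Quiver.Hom.unop
    (p.Φ.rightOp.map_add (f := f.unop) (g := g.unop))⟩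

/-- The termwise extension of the unit of `(Φ, Ψ)` on the first side to complexes. -/
noncomputable def unitC (X : CochainComplex A ℤ) :
    X ⟶ (mapComplex p.Ψ).obj (op ((mapComplex p.Φ).obj (op X))) where
  f i := (X.XIsoOfEq (neg_neg i)).inv ≫ p.adj.unit.app (X.X (- -i))
  comm' i j h := by
    have h1 := p.adj.unit.naturality (X.d (- -i) (- -j))
    have h2 : (X.XIsoOfEq (neg_neg i)).inv ≫ X.d (- -i) (- -j) =
      X.d i j ≫ (X.XIsoOfEq (neg_neg j)).inv := by simp
    change ((X.XIsoOfEq (neg_neg i)).inv ≫ p.adj.unit.app (X.X (- -i))) ≫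
      (p.Φ.rightOp ⋙ p.Ψ).map (X.d (- -i) (- -j)) =
      X.d i j ≫ (X.XIsoOfEq (neg_neg j)).inv ≫ p.adj.unit.app (X.X (- -j))
    rw [Category.assoc, ← h1, ← Category.assoc _ (X.XIsoOfEq (neg_neg j)).inv, ← h2]
    simp

/-- The termwise extension of the unit of `(Φ, Ψ)` on the second side to complexes. -/
noncomputable def counitC (Y : CochainComplex B ℤ) :
    Y ⟶ (mapComplex p.Φ).obj (op ((mapComplex p.Ψ).obj (op Y))) where
  f i := (Y.XIsoOfEq (neg_neg i)).inv ≫ (p.adj.counit.app (op (Y.X (- -i)))).unop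
  comm' i j h := by
    have h1 := congrArg Quiver.Hom.unop (p.adj.counit.naturality (Y.d (- -i) (- -j)).op)
    have h2 : (Y.XIsoOfEq (neg_neg i)).inv ≫ Y.d (- -i) (- -j) =
      Y.d i j ≫ (Y.XIsoOfEq (neg_neg j)).inv := by simp
    change ((Y.XIsoOfEq (neg_neg i)).inv ≫ (p.adj.counit.app (op (Y.X (- -i)))).unop) ≫
      ((p.Ψ ⋙ p.Φ.rightOp).map (Y.d (- -i) (- -j)).op).unop =
      Y.d i j ≫ (Y.XIsoOfEq (neg_neg j)).inv ≫ (p.adj.counit.app (op (Y.X (- -j)))).unop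
    rw [unop_comp, unop_comp] at h1
    rw [Category.assoc, h1, ← Category.assoc _ (Y.XIsoOfEq (neg_neg j)).inv, ← h2]
    simp

lemma XIsoOfEq_inv_f {V : Type*} [Category* V] [HasZeroMorphisms V] {X Y : CochainComplex V ℤ}
    (f : X ⟶ Y) {j i : ℤ} (h : j = i) :
    (X.XIsoOfEq h).inv ≫ f.f j = f.f i ≫ (Y.XIsoOfEq h).inv := by
  subst h
  simp

lemma map_XIsoOfEq {A' B' : Type*} [Category* A'] [Category* B'] [Abelian A'] [Abelian B']
    (F : A'ᵒᵖ ⥤ B') [F.Additive] (X : CochainComplex A' ℤ) {j i : ℤ} (h : j = i) :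
    (((mapComplex F).obj (op X)).XIsoOfEq h).inv ≫
      F.map (X.XIsoOfEq (congrArg Neg.neg h)).inv.op = 𝟙 _ := by
  subst h
  simp only [HomologicalComplex.XIsoOfEq_rfl, Iso.refl_inv, op_id]
  exact (Category.id_comp _).trans (F.map_id _)

lemma comp_aux {V : Type*} [Category* V] {a b c : V} (x : a ⟶ b) (u : b ⟶ c) (v : c ⟶ b)
    (w : b ⟶ a) (m : c ⟶ a) (hm : m = v ≫ w) (h1 : u ≫ v = 𝟙 b) (h2 : x ≫ w = 𝟙 a) :
    ((x ≫ u) ≫ 𝟙 c) ≫ m = 𝟙 a := by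
  rw [hm, Category.comp_id, Category.assoc, reassoc_of% h1, h2]

lemma comp_aux' {V : Type*} [Category* V] {a b c : V} (x : a ⟶ b) (u : b ⟶ c) (v : c ⟶ b)
    (w : b ⟶ a) (m : c ⟶ a) (hm : m = v ≫ w) (h1 : u ≫ v = 𝟙 b) (h2 : x ≫ w = 𝟙 a) :
    (x ≫ u) ≫ 𝟙 c ≫ m = 𝟙 a := by
  rw [hm, Category.id_comp, Category.assoc, reassoc_of% h1, h2]

/-- The adjunction on complexes given termwise by that of `(Φ, Ψ)`. -/
noncomputable def adjC : (mapComplex p.Φ).rightOp ⊣ mapComplex p.Ψ :=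
  Adjunction.mkOfUnitCounit
    { unit :=
        { app := p.unitC
          naturality := fun X Y f => by
            ext i
            have h1 := p.adj.unit.naturality (f.f (- -i))
            have h2 := XIsoOfEq_inv_f f (neg_neg i)
            change f.f i ≫ (Y.XIsoOfEq (neg_neg i)).inv ≫ p.adj.unit.app (Y.X (- -i)) =
              ((X.XIsoOfEq (neg_neg i)).inv ≫ p.adj.unit.app (X.X (- -i))) ≫
                (p.Φ.rightOp ⋙ p.Ψ).map (f.f (- -i))
            rw [Category.assoc, ← h1, ← Category.assoc, ← h2]
            simp }
      counit :=
        { app := fun Y => (p.counitC Y.unop).op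
          naturality := fun X Y f => by
            apply Quiver.Hom.unop_inj
            ext i
            have h1 := congrArg Quiver.Hom.unop (p.adj.counit.naturality (f.unop.f (- -i)).op)
            have h2 := XIsoOfEq_inv_f f.unop (neg_neg i)
            change ((Y.unop.XIsoOfEq (neg_neg i)).inv ≫
                (p.adj.counit.app (op (Y.unop.X (- -i)))).unop) ≫
                ((p.Ψ ⋙ p.Φ.rightOp).map (f.unop.f (- -i)).op).unop =
              f.unop.f i ≫ (X.unop.XIsoOfEq (neg_neg i)).inv ≫
                (p.adj.counit.app (op (X.unop.X (- -i)))).unop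
            rw [unop_comp, unop_comp] at h1
            rw [Category.assoc, h1, ← Category.assoc _ (X.unop.XIsoOfEq (neg_neg i)).inv, ← h2]
            simp }
      left_triangle := by
        ext X
        apply Quiver.Hom.unop_inj
        ext i
        have h1 := congrArg Quiver.Hom.unop (p.adj.left_triangle_components (X.X (- - -i)))
        have h2 := map_XIsoOfEq p.Φ X (neg_neg i)
        rw [unop_comp] at h1
        change (((((mapComplex p.Φ).obj (op X)).XIsoOfEq (neg_neg i)).inv ≫
          (p.adj.counit.app (op (p.Φ.obj (op (X.X (- - -i)))))).unop) ≫ 𝟙 _) ≫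
          p.Φ.map ((X.XIsoOfEq (neg_neg (-i))).inv ≫ p.adj.unit.app (X.X (- - -i))).op = 𝟙 _
        change (p.adj.counit.app (op (p.Φ.obj (op (X.X (- - -i)))))).unop ≫
          p.Φ.map (p.adj.unit.app (X.X (- - -i))).op = 𝟙 _ at h1
        exact comp_aux _ _ _ _ _ (by rw [op_comp]; exact p.Φ.map_comp _ _) h1 h2
      right_triangle := by
        ext Y i
        have h1 := p.adj.right_triangle_components (op (Y.unop.X (- - -i)))
        have h2 := map_XIsoOfEq p.Ψ Y.unop (neg_neg i)
        change (((mapComplex p.Ψ).obj Y).XIsoOfEq (neg_neg i)).inv ≫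
          p.Ψ.map (Y.unop.XIsoOfEq (neg_neg (-i))).inv.op = 𝟙 _ at h2
        change ((((mapComplex p.Ψ).obj Y).XIsoOfEq (neg_neg i)).inv ≫
          p.adj.unit.app (p.Ψ.obj (op (Y.unop.X (- - -i))))) ≫ 𝟙 _ ≫
          p.Ψ.map ((Y.unop.XIsoOfEq (neg_neg (-i))).inv ≫
            (p.adj.counit.app (op (Y.unop.X (- - -i)))).unop).op = 𝟙 _
        exact comp_aux' _ _ _ _ _ (by rw [op_comp, Quiver.Hom.op_unop]; exact p.Ψ.map_comp _ _) h1 h2 }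

/-- The adjunction on homotopy categories given termwise by that of `(Φ, Ψ)`. -/
noncomputable def adjK : (mapK p.Φ).rightOp ⊣ mapK p.Ψ :=
  Adjunction.mkOfUnitCounit
    { unit :=
        { app := fun X => (HomotopyCategory.quotient A (ComplexShape.up ℤ)).map (p.adjC.unit.app X.as)
          naturality := fun X Y f => by
            obtain ⟨f, rfl⟩ := (HomotopyCategory.quotient A (ComplexShape.up ℤ)).map_surjective f
            exact congrArg (HomotopyCategory.quotient A (ComplexShape.up ℤ)).map (p.adjC.unit.naturality f) }
      counit :=
        { app := fun Y => ((HomotopyCategory.quotient B (ComplexShape.up ℤ)).map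
            (p.adjC.counit.app (op Y.unop.as)).unop).op
          naturality := fun X Y f => by
            obtain ⟨g, hg⟩ :=
              (HomotopyCategory.quotient B (ComplexShape.up ℤ)).map_surjective f.unop
            obtain rfl : f = ((HomotopyCategory.quotient B (ComplexShape.up ℤ)).map g).op :=
              congrArg Quiver.Hom.op hg.symm
            exact congrArg (fun h => ((HomotopyCategory.quotient B (ComplexShape.up ℤ)).map
              (Quiver.Hom.unop h)).op) (p.adjC.counit.naturality g.op) }
      left_triangle := by
        ext X
        refine (congrArg (_ ≫ ·) (Category.id_comp _)).trans ?_
        exact congrArg (fun h => ((HomotopyCategory.quotient B (ComplexShape.up ℤ)).map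
          (Quiver.Hom.unop h)).op) (p.adjC.left_triangle_components X.as)
      right_triangle := by
        ext Y
        refine (congrArg (_ ≫ ·) (Category.id_comp _)).trans ?_
        exact congrArg (HomotopyCategory.quotient A (ComplexShape.up ℤ)).map
          (p.adjC.right_triangle_components (op Y.unop.as)) }

/-- The data needed to derive `(Φ, Ψ)` to a pair of functors between `D*(A)` and `D†(B)`:
the boundedness types, which are respected by `Φ` and `Ψ`, and the triangulated subcategories
`subP` and `subQ` whose objects compute the derived functors. -/
structure DerivedSetting where
  star : Boundedness
  dagger : Boundedness
  mapsΦ : ∀ X, star.prop A X → dagger.prop B ((mapK p.Φ).obj (op X))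
  mapsΨ : ∀ Y, dagger.prop B Y → star.prop A ((mapK p.Ψ).obj (op Y))
  subP : ObjectProperty (HoCat star A)
  subQ : ObjectProperty (HoCat dagger B)
  adaptedΦ : IsAdapted p.Φ star subP
  adaptedΨ : IsAdapted p.Ψ dagger subQ

end RightAdjointPair

namespace RightAdjointPair.DerivedSetting

variable {A : Type u₁} [Category.{v₁} A] [Abelian A]
    {B : Type u₂} [Category.{v₂} B] [Abelian B] {p : RightAdjointPair A B} (S : p.DerivedSetting)

/-- The termwise adjunction between `K*(A)` and `K†(B)`. -/
noncomputable def adjBounded : (mapBounded p.Φ S.mapsΦ).rightOp ⊣ mapBounded p.Ψ S.mapsΨ :=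
  p.adjK.restrictFullyFaithful (ObjectProperty.fullyFaithfulι _)
    (ObjectProperty.fullyFaithfulι (S.dagger.prop B)).op (Iso.refl _) (Iso.refl _)

/-- The right derived functor `R*Φ`. -/
noncomputable def RΦ : (DerCat S.star A)ᵒᵖ ⥤ DerCat S.dagger B := rightDerived p.Φ S.mapsΦ S.adaptedΦ
/-- The right derived functor `R†Ψ`. -/
noncomputable def RΨ : (DerCat S.dagger B)ᵒᵖ ⥤ DerCat S.star A := rightDerived p.Ψ S.mapsΨ S.adaptedΨ

/-- The morphism `Φ ⟶ R*Φ`, written in the opposite category. -/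
noncomputable def α : toDer S.star A ⋙ S.RΦ.rightOp ⟶
    (mapBounded p.Φ S.mapsΦ).rightOp ⋙ (toDer S.dagger B).op :=
  NatTrans.rightOp (rightDerivedUnit p.Φ S.mapsΦ S.adaptedΦ)

/-- The morphism `Ψ ⟶ R†Ψ`. -/
noncomputable def β : mapBounded p.Ψ S.mapsΨ ⋙ toDer S.star A ⟶
    (toDer S.dagger B).op ⋙ S.RΨ :=
  rightDerivedUnit p.Ψ S.mapsΨ S.adaptedΨ

lemma isIso_map_α {H : Type*} [Category* H] (G : (DerCat S.dagger B)ᵒᵖ ⥤ H) ⦃X Y : HoCat S.star A⦄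
    (f : X ⟶ Y) (hX : S.subP X) (hY : S.subP Y) (hf : qis S.star A f) :
    IsIso (((mapBounded p.Φ S.mapsΦ).rightOp ⋙ (toDer S.dagger B).op ⋙ G).map f) := by
  have := S.adaptedΦ.isIso_map S.mapsΦ f hX hY hf
  have : IsIso ((mapBounded p.Φ S.mapsΦ ⋙ toDer S.dagger B).map f.op).op := inferInstance
  exact inferInstanceAs
    (IsIso (G.map ((mapBounded p.Φ S.mapsΦ ⋙ toDer S.dagger B).map f.op).op))

lemma isIso_α_app (X : HoCat S.star A) (hX : S.subP X) : IsIso (S.α.app X) := by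
  have := isIso_rightDerivedUnit_app p.Φ S.mapsΦ S.adaptedΦ X hX
  exact inferInstanceAs
    (IsIso ((rightDerivedUnit p.Φ S.mapsΦ S.adaptedΦ).app (op X)).op)

lemma isIso_β_app (Y : HoCat S.dagger B) (hY : S.subQ Y) : IsIso (S.β.app (op Y)) :=
  isIso_rightDerivedUnit_app p.Ψ S.mapsΨ S.adaptedΨ Y hY

instance : S.RΦ.rightOp.IsLeftDerivedFunctor S.α (qis S.star A) :=
  have := S.adaptedΦ.isTriangulated
  isLeftDerivedFunctor_of_resolving S.subP (acyclic S.star A) S.adaptedΦ.exists_trW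
    (qis_eq S.star A) _ (S.isIso_map_α (𝟭 _)) S.α S.isIso_α_app

instance : S.RΨ.IsRightDerivedFunctor S.β (qis S.dagger B).op :=
  inferInstanceAs ((rightDerived p.Ψ S.mapsΨ S.adaptedΨ).IsRightDerivedFunctor
    (rightDerivedUnit p.Ψ S.mapsΨ S.adaptedΨ) (qis S.dagger B).op)

instance : (S.RΦ.rightOp ⋙ S.RΨ).IsLeftDerivedFunctor
    ((Functor.associator _ _ _).inv ≫ Functor.whiskerRight S.α S.RΨ) (qis S.star A) :=
  have := S.adaptedΦ.isTriangulated
  isLeftDerivedFunctor_of_resolving S.subP (acyclic S.star A) S.adaptedΦ.exists_trW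
    (qis_eq S.star A) _ (S.isIso_map_α S.RΨ) _ fun X hX => by
      have := S.isIso_α_app X hX
      change IsIso (𝟙 _ ≫ S.RΨ.map (S.α.app X))
      infer_instance

instance : (S.RΨ ⋙ S.RΦ.rightOp).IsRightDerivedFunctor
    (Functor.whiskerRight S.β S.RΦ.rightOp ≫ (Functor.associator _ _ _).hom)
    (qis S.dagger B).op :=
  have := S.adaptedΨ.isTriangulated
  (isRightDerivedFunctor_iff_of_resolving S.subQ (acyclic S.dagger B) S.adaptedΨ.exists_trW
    (qis_eq S.dagger B) _ (fun X Y f hX hY hf => by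
      have := S.adaptedΨ.isIso_map S.mapsΨ f hX hY hf
      exact inferInstanceAs (IsIso (S.RΦ.rightOp.map
        ((mapBounded p.Ψ S.mapsΨ ⋙ toDer S.star A).map f.op)))) _).2 fun Y hY => by
      have := S.isIso_β_app Y hY
      change IsIso (S.RΦ.rightOp.map (S.β.app (op Y)) ≫ 𝟙 _)
      infer_instance

/-- The derived adjunction: its unit is the one characterized by compatibility with the
termwise unit of `(Φ, Ψ)` and the morphisms `Φ ⟶ R*Φ` and `Ψ ⟶ R†Ψ`. -/
noncomputable def derivedAdj : S.RΦ.rightOp ⊣ S.RΨ :=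
  S.adjBounded.derived (qis S.star A) (qis S.dagger B).op S.α S.β

/-- A complex is `D`-reflexive if the unit of the derived adjunction at it is an isomorphism. -/
def IsReflexive (X : DerCat S.star A) : Prop := IsIso (S.derivedAdj.unit.app X)

/-- The cohomology object `H^i(R*Φ X)` of an object `X`, seen as a stalk complex. -/
noncomputable def HΦ (i : ℤ) (X : A) : B :=
  (cohomology S.dagger B i).obj (S.RΦ.obj (op ((stalk S.star A).obj X)))

/-- The cohomology object `H^i(R†Ψ Y)` of an object `Y`, seen as a stalk complex. -/
noncomputable def HΨ (i : ℤ) (Y : B) : A :=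
  (cohomology S.star A i).obj (S.RΨ.obj (op ((stalk S.dagger B).obj Y)))

/-- An object is `D`-reflexive if it is so as a stalk complex. -/
def IsReflexiveObj (X : A) : Prop := S.IsReflexive ((stalk S.star A).obj X)

/-- `X` is `Φ`-acyclic. -/
def IsΦAcyclic (X : A) : Prop := ∀ i : ℤ, i ≠ 0 → IsZero (S.HΦ i X)

/-- `Y` is `Ψ`-acyclic. -/
def IsΨAcyclic (Y : B) : Prop := ∀ i : ℤ, i ≠ 0 → IsZero (S.HΨ i Y)

/-- `Φ` has cohomological dimension at most `n`. -/
def CohDimLE (n : ℕ) : Prop := ∀ (X : A) (i : ℤ), (n : ℤ) < |i| → IsZero (S.HΦ i X)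

/-- The class `𝒢_{ΦΨ}`. -/
def G : ObjectProperty A := fun X =>
  S.IsΦAcyclic X ∧ S.IsΨAcyclic (p.Φ.obj (op X)) ∧ IsIso (p.adj.unit.app X)

end RightAdjointPair.DerivedSetting

end Adj

/-- `M` has left `F`-dimension at most `n`: there is an exact sequence
`⋯ ⟶ F₁ ⟶ F₀ ⟶ M ⟶ 0` with each `F i` in the class `F` or zero, and `F i` zero for `n < i`. -/
def LeftDimLE {A : Type*} [Category* A] [Abelian A] (F : ObjectProperty A) (M : A) (n : ℕ∞) :
    Prop :=
  ∃ (C : ChainComplex A ℕ) (ε : C.X 0 ⟶ M) (w : C.d 1 0 ≫ ε = 0),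
    (∀ i, F (C.X i) ∨ IsZero (C.X i)) ∧ (∀ i : ℕ, n < i → IsZero (C.X i)) ∧
    Epi ε ∧ (ShortComplex.mk _ _ w).Exact ∧ ∀ i, C.ExactAt (i + 1)

universe w

/-- `M` belongs to `FP_n`: there is an exact sequence `P (n-1) ⟶ ⋯ ⟶ P 0 ⟶ M ⟶ 0` of modules
with finitely generated projective `P i`. The complex `C` extends this sequence to the left by
arbitrary modules, and nothing is required in the degrees beyond `n - 1`. -/
def FP {R : Type*} [Ring R] (n : ℕ) (M : ModuleCat.{w} R) : Prop :=
  ∃ (C : ChainComplex (ModuleCat.{w} R) ℕ) (ε : C.X 0 ⟶ M) (w : C.d 1 0 ≫ ε = 0),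
    (∀ i < n, Module.Finite R (C.X i) ∧ Module.Projective R (C.X i)) ∧
    (0 < n → Epi ε) ∧ (1 < n → (ShortComplex.mk _ _ w).Exact) ∧
    ∀ i, i + 2 < n → C.ExactAt (i + 1)

end DerivedPair

universe u v w

/-! The proof is a dimension shift inside the class of reflexive objects, and rests on three facts.

Two out of three: if two terms of a short exact sequence are `D`-reflexive, so is the third. By
Yoneda and the derived adjunction, the unit at `X` is invertible exactly when `RΦ` is bijective on
morphisms into `X` (`isIso_unit_app_iff_fullyFaithfulAt`). That property passes along a
distinguished triangle by a five lemma argument (`FullyFaithfulAt.obj₃`), which only needs `RΦ` to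
reverse two consecutive morphisms of each triangle and to turn the shift into its inverse. No
compatibility of the unit with connecting morphisms has to be checked.

Acyclic objects: a `Φ`-acyclic `M` is reflexive if and only if it lies in `𝒢_{ΦΨ}`
(`isReflexiveObj_iff_of_isΦAcyclic`). Here `RΦ M` is the stalk `Φ M`, so the derived unit is `η_M`
followed by `ΨΦM ⟶ RΨ(ΦM)`. The latter is invertible on `H^0` because `Ψ` is left exact, and the
remaining cohomology of the target is that of `RΨ(ΦM)`.

Finitely generated projectives: they are retracts of some `R^n`, hence reflexive, and they are
`Φ`-acyclic, hence in `𝒢_{ΦΨ}`.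

If `M` has a finite `𝒢_{ΦΨ}`-resolution, two out of three gives reflexivity. Conversely, let `M` be
reflexive in `FP_n` with `H^i(RΦ M) = 0` for `i > n`. The kernel of a finitely generated projective
cover term `P ⟶ M` is reflexive, lies in `FP_{n-1}`, and its `H^i` vanish for `i > n - 1`. After `n`
steps the syzygy is reflexive and `Φ`-acyclic, so it is in `𝒢_{ΦΨ}` and closes the resolution. -/

namespace DerivedPair

/-! ### Cohomology and distinguished triangles in the derived categories. -/

section DerivedCategory

variable (s : Boundedness) (A : Type*) [Category* A] [Abelian A]

instance : (qis s A).HasLeftCalculusOfFractions := by rw [qis_eq]; infer_instance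

instance : (qis s A).HasRightCalculusOfFractions := by rw [qis_eq]; infer_instance

instance : (qis s A).IsCompatibleWithTriangulation := by rw [qis_eq]; infer_instance

instance : (toDer s A).mapArrow.EssSurj := Localization.essSurj_mapArrow _ (qis s A)

/-- The cohomology of the image in `D*(A)` of a complex is the homology of that complex. -/
noncomputable def cohomologyFac (i : ℤ) : toDer s A ⋙ cohomology s A i ≅
    (s.prop A).ι ⋙ HomotopyCategory.homologyFunctor A (ComplexShape.up ℤ) i :=
  Localization.fac _ _ _

instance (i : ℤ) : (cohomology s A i).IsHomological :=
  Functor.isHomological_of_localization (toDer s A) _ _ (cohomologyFac s A i)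

variable {s A}

/-- By the calculus of fractions, every morphism of `D*(A)` is isomorphic, as an arrow, to the image
of one of `K*(A)`; that one is then a quasi-isomorphism. -/
lemma isIso_of_cohomology {X Y : DerCat s A} (f : X ⟶ Y)
    (hf : ∀ i, IsIso ((cohomology s A i).map f)) : IsIso f := by
  let e := (toDer s A).mapArrow.objObjPreimageIso (Arrow.mk f)
  let g := (toDer s A).mapArrow.objPreimage (Arrow.mk f)
  have hg : qis s A g.hom := fun i => by
    have h1 : IsIso ((cohomology s A i).map ((toDer s A).map g.hom)) :=
      ((MorphismProperty.isomorphisms A).arrow_mk_iso_iff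
        ((cohomology s A i).mapArrow.mapIso e)).2 (hf i)
    exact ((MorphismProperty.isomorphisms A).arrow_mk_iso_iff
      (((Functor.mapArrowFunctor _ _).mapIso (cohomologyFac s A i)).app g)).1 h1
  have := Localization.inverts (toDer s A) (qis s A) g.hom hg
  exact ((MorphismProperty.isomorphisms _).arrow_mk_iso_iff e).1 this

lemma isIso_cohomology_map_toDer_iff {X Y : HoCat s A} (f : X ⟶ Y) (i : ℤ) :
    IsIso ((cohomology s A i).map ((toDer s A).map f)) ↔
      IsIso ((HomotopyCategory.homologyFunctor A (ComplexShape.up ℤ) i).map f.hom) :=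
  (MorphismProperty.isomorphisms A).arrow_mk_iso_iff
    (((Functor.mapArrowFunctor _ _).mapIso (cohomologyFac s A i)).app (Arrow.mk f))

lemma isZero_cohomology_toDer_iff (X : HoCat s A) (i : ℤ) :
    IsZero ((cohomology s A i).obj ((toDer s A).obj X)) ↔ HomologicalComplex.ExactAt X.obj.as i := by
  rw [HomologicalComplex.exactAt_iff_isZero_homology]
  exact ((cohomologyFac s A i).app X ≪≫
    (HomotopyCategory.homologyFunctorFactors A (ComplexShape.up ℤ) i).app X.obj.as).isZero_iff

lemma isZero_cohomology_shift_iff (X : DerCat s A) {a i j : ℤ} (h : a + i = j) :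
    IsZero ((cohomology s A i).obj (X⟦a⟧)) ↔ IsZero ((cohomology s A j).obj X) := by
  let Y := (toDer s A).objPreimage X
  let e : (toDer s A).obj Y ≅ X := (toDer s A).objObjPreimageIso X
  let e' : (toDer s A).obj (Y⟦a⟧) ≅ X⟦a⟧ :=
    ((toDer s A).commShiftIso a).app Y ≪≫ (shiftFunctor _ a).mapIso e
  rw [← ((cohomology s A i).mapIso e').isZero_iff, ← ((cohomology s A j).mapIso e).isZero_iff]
  refine ((cohomologyFac s A i).app (Y⟦a⟧)).isZero_iff.trans
    (Iff.trans ?_ ((cohomologyFac s A j).app Y).isZero_iff.symm)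
  exact ((HomotopyCategory.homologyFunctor A (ComplexShape.up ℤ) i).mapIso
    (((s.prop A).ι.commShiftIso a).app Y) ≪≫
    ((HomotopyCategory.homologyFunctor A (ComplexShape.up ℤ) 0).shiftIso a i j h).app Y.obj).isZero_iff

/-- The cone of the first map of a short exact sequence is quasi-isomorphic to its third term. -/
lemma exists_distinguished_of_shortExact {S : ShortComplex A} (hS : S.ShortExact) :
    ∃ h, Triangle.mk ((stalk s A).map S.f) ((stalk s A).map S.g) h ∈ distTriang (DerCat s A) := by
  let F := CochainComplex.singleFunctor A 0
  let φ := F.map S.f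
  have hS' : (S.map F).ShortExact := hS.map_of_exact (HomologicalComplex.single A (ComplexShape.up ℤ) 0)
  have hq := CochainComplex.mappingCone.quasiIso_descShortComplex hS'
  -- The cone `C` is taken in `K*(A)`; `e` identifies it in `K(A)` with the explicit mapping cone,
  -- where the quasi-isomorphism to the third term is available.
  obtain ⟨C, u, v, hT⟩ := distinguished_cocone_triangle ((stalkK s A).map S.f)
  let e := isoTriangleOfIso₁₂ _ _ ((s.prop A).ι.map_distinguished _ hT)
    (HomotopyCategory.mappingCone_triangleh_distinguished φ) (Iso.refl _) (Iso.refl _)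
    ((Category.comp_id _).trans (Category.id_comp _).symm)
  have he : u.hom ≫ e.hom.hom₃ = (CochainComplex.mappingCone.triangleh φ).mor₂ :=
    e.hom.comm₂.trans (Category.id_comp _)
  let δ := (HomotopyCategory.quotient _ _).map (CochainComplex.mappingCone.descShortComplex (S.map F))
  have hδ : (CochainComplex.mappingCone.triangleh φ).mor₂ ≫ δ =
      (HomotopyCategory.quotient _ _).map (F.map S.g) := by
    refine ((HomotopyCategory.quotient _ _).map_comp _ _).symm.trans (congrArg _ ?_)
    exact CochainComplex.mappingCone.inr_descShortComplex (S.map F)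
  let d : C ⟶ (stalkK s A).obj S.X₃ := (s.prop A).homMk (e.hom.hom₃ ≫ δ)
  have hd : qis s A d :=
    (HomotopyCategory.quasiIso A (ComplexShape.up ℤ)).comp_mem _ _
      ((HomotopyCategory.quasiIso A (ComplexShape.up ℤ)).of_isIso (Triangle.π₃.mapIso e).hom)
      ((HomotopyCategory.quotient_map_mem_quasiIso_iff _).2 hq)
  let δ' : (toDer s A).obj C ⟶ (stalk s A).obj S.X₃ := (toDer s A).map d
  have : IsIso δ' := Localization.inverts (toDer s A) (qis s A) d hd
  have hc : u ≫ d = (stalkK s A).map S.g := by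
    ext
    exact (Category.assoc _ _ _).symm.trans ((congrArg (· ≫ δ) he).trans hδ)
  let ε : (toDer s A).obj C ≅ (stalk s A).obj S.X₃ := asIso δ'
  let T := (toDer s A).mapTriangle.obj (Triangle.mk ((stalkK s A).map S.f) u v)
  let T' : Triangle (DerCat s A) :=
    Triangle.mk ((stalk s A).map S.f) ((stalk s A).map S.g) (ε.inv ≫ T.mor₃)
  refine ⟨ε.inv ≫ T.mor₃, ?_⟩
  refine isomorphic_distinguished T ((toDer s A).map_distinguished _ hT) _ ?_
  refine (Triangle.isoMk T T' (Iso.refl _) (Iso.refl _) ε ?_ ?_ ?_).symm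
  · exact (Category.comp_id _).trans (Category.id_comp _).symm
  · exact ((toDer s A).map_comp _ _).symm.trans ((congrArg _ hc).trans (Category.id_comp _).symm)
  · exact (congrArg (T.mor₃ ≫ ·) (CategoryTheory.Functor.map_id _ _)).trans
      ((Category.comp_id _).trans (ε.hom_inv_id_assoc _).symm)

end DerivedCategory
-- Contravariant functors and distinguished triangles.
section WeaklyTriangulated

variable {C D E C₀ : Type*} [Category* C] [Category* D] [Category* E] [Category* C₀]
  [HasZeroObject C] [HasShift C ℤ] [Preadditive C]
  [∀ n : ℤ, (shiftFunctor C n).Additive] [Pretriangulated C]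
  [HasZeroObject D] [HasShift D ℤ] [Preadditive D]
  [∀ n : ℤ, (shiftFunctor D n).Additive] [Pretriangulated D]
  [HasZeroObject E] [HasShift E ℤ] [Preadditive E]
  [∀ n : ℤ, (shiftFunctor E n).Additive] [Pretriangulated E]
  [HasZeroObject C₀] [HasShift C₀ ℤ] [Preadditive C₀]
  [∀ n : ℤ, (shiftFunctor C₀ n).Additive] [Pretriangulated C₀]

/-- The contravariant functor `F` maps the first two morphisms of the triangle `T` to the first
two morphisms of a distinguished triangle. -/
def ReversesTriangle (F : Cᵒᵖ ⥤ D) (T : Triangle C) : Prop :=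
  ∃ h, Triangle.mk (F.map T.mor₂.op) (F.map T.mor₁.op) h ∈ distTriang D

/-- A contravariant functor is weakly triangulated if it maps the first two morphisms of every
distinguished triangle to the first two morphisms of a distinguished triangle. -/
def IsWeaklyTriangulated (F : Cᵒᵖ ⥤ D) : Prop :=
  ∀ T ∈ distTriang C, ReversesTriangle F T

/-- The third morphism is left free, so it may be defined by transport from `T'`. -/
lemma reversesTriangle_of_iso' {F : Cᵒᵖ ⥤ D} {T : Triangle C} {T' : Triangle D}
    (hT' : T' ∈ distTriang D) (e₁ : F.obj (op T.obj₃) ≅ T'.obj₁) (e₂ : F.obj (op T.obj₂) ≅ T'.obj₂)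
    (e₃ : F.obj (op T.obj₁) ≅ T'.obj₃) (h₁ : F.map T.mor₂.op ≫ e₂.hom = e₁.hom ≫ T'.mor₁)
    (h₂ : F.map T.mor₁.op ≫ e₃.hom = e₂.hom ≫ T'.mor₂) : ReversesTriangle F T :=
  ⟨e₃.hom ≫ T'.mor₃ ≫ e₁.inv⟦1⟧', isomorphic_distinguished T' hT' _
    (Triangle.isoMk _ _ e₁ e₂ e₃ h₁ h₂ (by
      have : e₁.inv⟦(1 : ℤ)⟧' ≫ e₁.hom⟦(1 : ℤ)⟧' = 𝟙 _ := by simp [← Functor.map_comp]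
      exact (Category.assoc _ _ _).trans (congrArg (e₃.hom ≫ ·) ((Category.assoc _ _ _).trans
        ((congrArg (T'.mor₃ ≫ ·) this).trans (Category.comp_id _))))))⟩

lemma ReversesTriangle.of_iso {F : Cᵒᵖ ⥤ D} {T T' : Triangle C} (e : T ≅ T')
    (h : ReversesTriangle F T') : ReversesTriangle F T := by
  obtain ⟨δ, h⟩ := h
  refine reversesTriangle_of_iso' h (F.mapIso (Triangle.π₃.mapIso e).symm.op)
    (F.mapIso (Triangle.π₂.mapIso e).symm.op) (F.mapIso (Triangle.π₁.mapIso e).symm.op) ?_ ?_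
  · refine (F.map_comp _ _).symm.trans (Eq.trans ?_ (F.map_comp _ _))
    exact F.congr_map (congrArg Quiver.Hom.op e.inv.comm₂.symm)
  · refine (F.map_comp _ _).symm.trans (Eq.trans ?_ (F.map_comp _ _))
    exact F.congr_map (congrArg Quiver.Hom.op e.inv.comm₁.symm)

lemma ReversesTriangle.comp {F : Cᵒᵖ ⥤ D} {T : Triangle C} (h : ReversesTriangle F T)
    (G : D ⥤ E) [G.CommShift ℤ] [G.IsTriangulated] : ReversesTriangle (F ⋙ G) T := by
  obtain ⟨δ, h⟩ := h
  exact ⟨_, G.map_distinguished _ h⟩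

lemma ReversesTriangle.of_natIso {F G : Cᵒᵖ ⥤ D} {T : Triangle C} (h : ReversesTriangle F T)
    (e : G ≅ F) : ReversesTriangle G T := by
  obtain ⟨δ, h⟩ := h
  exact reversesTriangle_of_iso' h (e.app _) (e.app _) (e.app _)
    (e.hom.naturality _) (e.hom.naturality _)

lemma IsWeaklyTriangulated.op_comp {F : Cᵒᵖ ⥤ D} (h : IsWeaklyTriangulated F)
    (G : C₀ ⥤ C) [G.CommShift ℤ] [G.IsTriangulated] : IsWeaklyTriangulated (G.op ⋙ F) :=
  fun _ hT => h _ (G.map_distinguished _ hT)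

/-- Weak triangulatedness can be checked after a localization on the source. -/
lemma isWeaklyTriangulated_of_lift {F : Cᵒᵖ ⥤ D} (L : C₀ ⥤ C) [L.CommShift ℤ] [L.IsTriangulated]
    [L.mapArrow.EssSurj] (h : IsWeaklyTriangulated (L.op ⋙ F)) : IsWeaklyTriangulated F := by
  intro T hT
  obtain ⟨T', e, hT'⟩ := (L.distTriang_iff T).1 hT
  exact ReversesTriangle.of_iso e (h T' hT')

/-- A weakly triangulated functor restricts to full triangulated subcategories. -/
lemma isWeaklyTriangulated_of_comp_ι (P : ObjectProperty D) [P.IsTriangulated]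
    (F : Cᵒᵖ ⥤ P.FullSubcategory) (h : IsWeaklyTriangulated (F ⋙ P.ι)) :
    IsWeaklyTriangulated F := by
  intro T hT
  obtain ⟨δ, h⟩ := h T hT
  -- A cone formed inside the subcategory is isomorphic to the one given in `D`, and fullness lifts
  -- the isomorphism.
  obtain ⟨Z, u, v, hZ⟩ := distinguished_cocone_triangle (F.map T.mor₂.op)
  let e := isoTriangleOfIso₁₂ _ _ (P.ι.map_distinguished _ hZ) h (Iso.refl _) (Iso.refl _)
    ((Category.comp_id _).trans (Category.id_comp _).symm)
  refine reversesTriangle_of_iso' hZ (Iso.refl _) (Iso.refl _)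
    (P.ι.preimageIso (Triangle.π₃.mapIso e).symm)
    ((Category.comp_id _).trans (Category.id_comp _).symm) ?_
  apply P.ι.map_injective
  rw [P.ι.map_comp]
  refine (congrArg (_ ≫ ·) (P.ι.map_preimage _)).trans ?_
  exact e.inv.comm₂

end WeaklyTriangulated

/-! ### Derived categories as localizations of the resolving subcategories. -/

section Resolving

variable {C D : Type*} [Category* C] [Category* D] [HasZeroObject C] [HasShift C ℤ] [Preadditive C]
  [∀ n : ℤ, (shiftFunctor C n).Additive] [Pretriangulated C] [IsTriangulated C]
  (P B : ObjectProperty C) [P.IsTriangulated] [B.IsTriangulated] [B.IsClosedUnderIsomorphisms]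

/-- If every object has a resolution by an object of `P`, the localization of `C` is a
localization of `P`. -/
lemma isLocalization_ι_comp (hres : ∀ X : C, ∃ (Y : C) (f : Y ⟶ X), P Y ∧ B.trW f)
    (L : C ⥤ D) [L.IsLocalization B.trW] :
    (P.ι ⋙ L).IsLocalization (B.inverseImage P.ι).trW := by
  have : P.IsVerdierLeftLocalizing B := by
    rw [ObjectProperty.isVerdierLeftLocalizing_iff]
    intro X Y s hY hs
    obtain ⟨Z, f, hZ, hf⟩ := hres X
    exact ⟨Z, f ≫ s, f, hZ, trW_inf P B _ hZ hY (B.trW.comp_mem _ _ hf hs), rfl⟩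
  let T := P.triangulatedLocalizerMorphism B
  have : T.HasLeftResolutions := fun X => by
    obtain ⟨Z, f, hZ, hf⟩ := hres X
    exact ⟨LocalizerMorphism.LeftResolution.mk (Φ := T) (X₁ := (⟨Z, hZ⟩ : P.FullSubcategory)) f hf⟩
  let F := T.localizedFunctor (B.inverseImage P.ι).trW.Q B.trW.Q
  have : (T.functor ⋙ B.trW.Q).EssSurj := T.essSurj_of_hasLeftResolutions B.trW.Q
  have : ((B.inverseImage P.ι).trW.Q ⋙ F).EssSurj :=
    Functor.essSurj_of_iso (CatCommSq.iso T.functor _ B.trW.Q F)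
  have : F.EssSurj := ⟨fun Y => ⟨_, ⟨((B.inverseImage P.ι).trW.Q ⋙ F).objObjPreimageIso Y⟩⟩⟩
  -- Full faithfulness comes from the Verdier condition, essential surjectivity from the
  -- resolutions.
  have : F.IsEquivalence := { }
  have := LocalizerMorphism.IsLocalizedEquivalence.mk' T (B.inverseImage P.ι).trW.Q B.trW.Q F
  exact LocalizerMorphism.IsLocalizedEquivalence.isLocalization T L

end Resolving

/-! ### Reversal of triangles by the derived functor. -/

section

variable {A B : Type*} [Category* A] [Category* B] [Abelian A] [Abelian B]
variable (F : Aᵒᵖ ⥤ B) [F.Additive]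

/-- Distinguished triangles of `K(A)` come from degreewise split short exact sequences of complexes,
and an additive functor preserves splittings. This avoids comparing mapping cones under a
contravariant functor. -/
lemma isWeaklyTriangulated_mapK : IsWeaklyTriangulated (mapK F) := by
  intro T hT
  obtain ⟨S, σ, ⟨e⟩⟩ := (HomotopyCategory.distinguished_iff_iso_trianglehOfDegreewiseSplit T).1 hT
  refine ReversesTriangle.of_iso e ?_
  let S' : ShortComplex (CochainComplex B ℤ) :=
    ShortComplex.mk ((mapComplex F).map S.g.op) ((mapComplex F).map S.f.op) (by
      ext n
      refine (F.map_comp _ _).symm.trans ?_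
      refine (F.congr_map (congrArg Quiver.Hom.op
        ((HomologicalComplex.congr_hom S.zero (-n) :)))).trans (F.map_zero _ _))
  let σ' (n : ℤ) : (S'.map (HomologicalComplex.eval B _ n)).Splitting := (σ (-n)).op.map F
  exact ⟨_, (HomotopyCategory.distinguished_iff_iso_trianglehOfDegreewiseSplit _).2
    ⟨S', σ', ⟨Iso.refl _⟩⟩⟩

variable {s t : Boundedness} (h : ∀ X, s.prop A X → t.prop B ((mapK F).obj (op X)))

lemma isWeaklyTriangulated_mapBounded : IsWeaklyTriangulated (mapBounded F h) :=
  isWeaklyTriangulated_of_comp_ι _ _ ((isWeaklyTriangulated_mapK F).op_comp (s.prop A).ι)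

variable {F} {P : ObjectProperty (HoCat s A)} (hP : IsAdapted F s P)

include hP in
lemma IsAdapted.isLocalization [P.IsTriangulated] :
    (P.ι ⋙ toDer s A).IsLocalization ((acyclic s A).inverseImage P.ι).trW := by
  have : (toDer s A).IsLocalization (acyclic s A).trW := by rw [← qis_eq]; infer_instance
  exact isLocalization_ι_comp P (acyclic s A) hP.exists_trW (toDer s A)

/-- On the complexes of `P`, the derived functor of `F` is given by `F`. -/
noncomputable def rightDerivedIso :
    (P.ι ⋙ toDer s A).op ⋙ rightDerived F h hP ≅ P.ι.op ⋙ mapBounded F h ⋙ toDer t B :=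
  have (X : P.FullSubcategoryᵒᵖ) :
      IsIso ((Functor.whiskerLeft P.ι.op (rightDerivedUnit F h hP)).app X) :=
    isIso_rightDerivedUnit_app F h hP X.unop.obj X.unop.2
  have := NatIso.isIso_of_isIso_app (Functor.whiskerLeft P.ι.op (rightDerivedUnit F h hP))
  (asIso (Functor.whiskerLeft P.ι.op (rightDerivedUnit F h hP))).symm

/-- Triangles of `D*(A)` lift, up to isomorphism, to triangles of `P`, where the derived functor is
`F` itself. -/
lemma isWeaklyTriangulated_rightDerived : IsWeaklyTriangulated (rightDerived F h hP) := by
  have := hP.isTriangulated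
  have := hP.isLocalization
  have := Localization.essSurj_mapArrow (P.ι ⋙ toDer s A) ((acyclic s A).inverseImage P.ι).trW
  refine isWeaklyTriangulated_of_lift (P.ι ⋙ toDer s A) fun T hT => ?_
  refine ReversesTriangle.of_natIso ?_ (rightDerivedIso h hP)
  exact ((((isWeaklyTriangulated_mapBounded F h).op_comp P.ι) T hT).comp (toDer t B))

end

/-! ### Contravariant functors and the shift. -/

section ReversesShift

variable {C D E C₀ : Type*} [Category* C] [Category* D] [Category* E] [Category* C₀]
  [HasShift C ℤ] [HasShift D ℤ] [HasShift E ℤ] [HasShift C₀ ℤ]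

/-- The contravariant functor `F` transforms the shift by `1` into the shift by `-1`. -/
def ReversesShift (F : Cᵒᵖ ⥤ D) : Prop :=
  Nonempty ((shiftFunctor C (1 : ℤ)).op ⋙ F ≅ F ⋙ shiftFunctor D (-1 : ℤ))

lemma ReversesShift.op_comp {F : Cᵒᵖ ⥤ D} (h : ReversesShift F) (G : C₀ ⥤ C) [G.CommShift ℤ] :
    ReversesShift (G.op ⋙ F) := by
  obtain ⟨e⟩ := h
  exact ⟨Functor.isoWhiskerRight (NatIso.op (G.commShiftIso (1 : ℤ)).symm) F ≪≫
    Functor.isoWhiskerLeft G.op e⟩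

lemma ReversesShift.comp {F : Cᵒᵖ ⥤ D} (h : ReversesShift F) (G : D ⥤ E) [G.CommShift ℤ] :
    ReversesShift (F ⋙ G) := by
  obtain ⟨e⟩ := h
  exact ⟨Functor.isoWhiskerRight e G ≪≫ Functor.isoWhiskerLeft F (G.commShiftIso (-1 : ℤ))⟩

lemma ReversesShift.of_natIso {F G : Cᵒᵖ ⥤ D} (h : ReversesShift F) (e : G ≅ F) :
    ReversesShift G := by
  obtain ⟨e'⟩ := h
  exact ⟨Functor.isoWhiskerLeft _ e ≪≫ e' ≪≫ Functor.isoWhiskerRight e.symm _⟩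

lemma reversesShift_of_lift {F : Cᵒᵖ ⥤ D} (L : C₀ ⥤ C) (W : MorphismProperty C₀)
    [L.IsLocalization W] [L.CommShift ℤ] (h : ReversesShift (L.op ⋙ F)) : ReversesShift F := by
  obtain ⟨e⟩ := h
  let e' : L.op ⋙ (shiftFunctor C (1 : ℤ)).op ⋙ F ≅ L.op ⋙ F ⋙ shiftFunctor D (-1 : ℤ) :=
    Functor.isoWhiskerRight (NatIso.op (L.commShiftIso (1 : ℤ))) F ≪≫ e
  have : Localization.Lifting L.op W.op (L.op ⋙ (shiftFunctor C (1 : ℤ)).op ⋙ F)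
    ((shiftFunctor C (1 : ℤ)).op ⋙ F) := ⟨Iso.refl _⟩
  have : Localization.Lifting L.op W.op (L.op ⋙ F ⋙ shiftFunctor D (-1 : ℤ))
    (F ⋙ shiftFunctor D (-1 : ℤ)) := ⟨Iso.refl _⟩
  exact ⟨Localization.liftNatIso L.op W.op _ _ _ _ e'⟩

lemma reversesShift_of_comp_ι (P : ObjectProperty D) [P.IsStableUnderShift ℤ]
    (F : Cᵒᵖ ⥤ P.FullSubcategory) (h : ReversesShift (F ⋙ P.ι)) : ReversesShift F := by
  obtain ⟨e⟩ := h
  exact ⟨((P.fullyFaithfulι).whiskeringRight Cᵒᵖ).preimageIso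
    (e ≪≫ Functor.isoWhiskerLeft F (P.ι.commShiftIso (-1 : ℤ)).symm)⟩

end ReversesShift

section

variable {A B : Type*} [Category* A] [Category* B] [Abelian A] [Abelian B]
variable (F : Aᵒᵖ ⥤ B) [F.Additive]

/-- The termwise extension of a contravariant functor transforms the shift by `1` into the shift
by `-1`. -/
noncomputable def mapComplexShiftIso :
    (shiftFunctor (CochainComplex A ℤ) (1 : ℤ)).op ⋙ mapComplex F ≅
      mapComplex F ⋙ shiftFunctor (CochainComplex B ℤ) (-1 : ℤ) :=
  NatIso.ofComponents (fun X => HomologicalComplex.Hom.isoOfComponents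
    (fun i => F.mapIso (X.unop.XIsoOfEq (show -(i + -1) = -i + 1 by lia)).op) (by
      rintro i j h
      change F.map (X.unop.XIsoOfEq _).hom.op ≫
          ((-1 : ℤ).negOnePow • F.map (X.unop.d (-(j + -1)) (-(i + -1))).op) =
        F.map ((1 : ℤ).negOnePow • X.unop.d (-j + 1) (-i + 1)).op ≫
          F.map (X.unop.XIsoOfEq _).hom.op
      -- The shifts by `1` and by `-1` both negate the differential, so the isomorphism needs no
      -- signs.
      rw [Int.negOnePow_neg, Int.negOnePow_one, Units.neg_smul, one_smul, Units.neg_smul, one_smul,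
        op_neg, F.map_neg, Preadditive.comp_neg, Preadditive.neg_comp, ← F.map_comp, ← F.map_comp,
        ← op_comp, ← op_comp, HomologicalComplex.XIsoOfEq_hom_comp_d,
        HomologicalComplex.d_comp_XIsoOfEq_hom])) (by
      intro X Y f
      ext i
      change F.map (f.unop.f (-i + 1)).op ≫ F.map (Y.unop.XIsoOfEq _).hom.op =
        F.map (X.unop.XIsoOfEq _).hom.op ≫ F.map (f.unop.f (-(i + -1))).op
      rw [← F.map_comp, ← F.map_comp, ← op_comp, ← op_comp,
        HomologicalComplex.XIsoOfEq_hom_naturality])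

lemma reversesShift_mapK : ReversesShift (mapK F) := by
  let Q := HomotopyCategory.quotient A (ComplexShape.up ℤ)
  let Q' := HomotopyCategory.quotient B (ComplexShape.up ℤ)
  let e₁ : (Q ⋙ shiftFunctor _ (1 : ℤ)).op ⋙ mapK F ≅ (shiftFunctor _ (1 : ℤ) ⋙ Q).op ⋙ mapK F :=
    Functor.isoWhiskerRight (NatIso.op (Q.commShiftIso (1 : ℤ))) (mapK F)
  let e₂ : ((shiftFunctor _ (1 : ℤ)).op ⋙ mapComplex F) ⋙ Q' ≅
    (mapComplex F ⋙ shiftFunctor _ (-1 : ℤ)) ⋙ Q' :=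
      Functor.isoWhiskerRight (mapComplexShiftIso F) Q'
  let e₃ := Functor.isoWhiskerLeft (mapComplex F) (Q'.commShiftIso (-1 : ℤ))
  let e : Q.op ⋙ (shiftFunctor _ (1 : ℤ)).op ⋙ mapK F ≅ Q.op ⋙ mapK F ⋙ shiftFunctor _ (-1 : ℤ) :=
    e₁ ≪≫ e₂ ≪≫ e₃
  -- Since the quotient functor is full and bijective on objects, naturality on complexes descends
  -- to the homotopy category.
  exact ⟨NatIso.ofComponents (fun X => e.app (op X.unop.as)) (by
    intro X Y f
    obtain ⟨g, hg⟩ := Q.map_surjective f.unop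
    obtain rfl : f = (Q.map g).op := congrArg Quiver.Hom.op hg.symm
    exact e.hom.naturality g.op)⟩

variable {s t : Boundedness} (h : ∀ X, s.prop A X → t.prop B ((mapK F).obj (op X)))

lemma reversesShift_mapBounded : ReversesShift (mapBounded F h) :=
  reversesShift_of_comp_ι _ _ ((reversesShift_mapK F).op_comp (s.prop A).ι)

variable {F} {P : ObjectProperty (HoCat s A)} (hP : IsAdapted F s P)

lemma reversesShift_rightDerived : ReversesShift (rightDerived F h hP) := by
  have := hP.isTriangulated
  have := hP.isLocalization
  refine reversesShift_of_lift (P.ι ⋙ toDer s A) ((acyclic s A).inverseImage P.ι).trW ?_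
  refine ReversesShift.of_natIso ?_ (rightDerivedIso h hP)
  exact (((reversesShift_mapBounded F h).op_comp P.ι)).comp (toDer t B)

end

/-! ### Reflexivity as full faithfulness, and two out of three in triangles. -/

section FullyFaithfulAt

variable {C D : Type*} [Category* C] [Category* D]

/-- The contravariant functor `F` is bijective on the morphisms with target `X`. -/
def FullyFaithfulAt (F : Cᵒᵖ ⥤ D) (X : C) : Prop :=
  ∀ W : C, Function.Bijective (fun f : W ⟶ X => F.map f.op)

lemma bijective_op_map_of_iso {F : Cᵒᵖ ⥤ D} {W W' X X' : C} (e : W ≅ W') (e' : X ≅ X')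
    (h : Function.Bijective (fun f : W ⟶ X => F.map f.op)) :
    Function.Bijective (fun f : W' ⟶ X' => F.map f.op) := by
  have : (fun f : W' ⟶ X' => F.map f.op) =
      ((F.mapIso e'.op).symm.homCongr (F.mapIso e.op).symm) ∘ (fun f : W ⟶ X => F.map f.op) ∘
        (e.homCongr e').symm := by
    ext f
    simp [Iso.homCongr, ← Functor.map_comp, ← op_comp]
  rw [this]
  exact (Equiv.bijective _).comp (h.comp (Equiv.bijective _))

lemma FullyFaithfulAt.of_iso {F : Cᵒᵖ ⥤ D} {X X' : C} (h : FullyFaithfulAt F X) (e : X ≅ X') :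
    FullyFaithfulAt F X' :=
  fun W => bijective_op_map_of_iso (Iso.refl W) e (h W)

/-- Composing with the unit at `X` is the action of `F` on morphisms followed by the adjunction
bijection; Yoneda concludes. -/
lemma isIso_unit_app_iff_fullyFaithfulAt {F : Cᵒᵖ ⥤ D} {G : Dᵒᵖ ⥤ C} (adj : F.rightOp ⊣ G) (X : C) :
    IsIso (adj.unit.app X) ↔ FullyFaithfulAt F X := by
  have key (W : C) : (fun f : W ⟶ X => f ≫ adj.unit.app X) =
      (adj.homEquiv W (op (F.obj (op X)))) ∘ Quiver.Hom.op ∘ (fun f : W ⟶ X => F.map f.op) := by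
    ext f
    exact ((adj.homEquiv_unit ..).trans (adj.unit.naturality f).symm).symm
  have hop {Y Z : D} : Function.Bijective (Quiver.Hom.op : (Y ⟶ Z) → _) :=
    ⟨Quiver.Hom.op_inj, fun f => ⟨f.unop, rfl⟩⟩
  rw [isIso_iff_yoneda_map_bijective]
  refine forall_congr' fun W => ?_
  refine (iff_of_eq (congrArg Function.Bijective (key W))).trans ?_
  rw [Function.Bijective.of_comp_iff' (Equiv.bijective _), Function.Bijective.of_comp_iff' hop]

/-- Both shifts are equivalences, and every test object is a shift, namely of `W⟦-1⟧`. -/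
lemma fullyFaithfulAt_shift_iff [HasShift C ℤ] [HasShift D ℤ] {F : Cᵒᵖ ⥤ D} (hF : ReversesShift F)
    (X : C) : FullyFaithfulAt F (X⟦(1 : ℤ)⟧) ↔ FullyFaithfulAt F X := by
  obtain ⟨e⟩ := hF
  have key (W : C) : Function.Bijective (fun f : W⟦(1 : ℤ)⟧ ⟶ X⟦(1 : ℤ)⟧ => F.map f.op) ↔
      Function.Bijective (fun f : W ⟶ X => F.map f.op) := by
    have h1 : (fun f : W⟦(1 : ℤ)⟧ ⟶ X⟦(1 : ℤ)⟧ => F.map f.op) ∘ (fun f : W ⟶ X => f⟦(1 : ℤ)⟧') =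
        (((e.app (op X)).homCongr (e.app (op W))).symm ∘ fun f => f⟦(-1 : ℤ)⟧') ∘
          (fun f : W ⟶ X => F.map f.op) := by
      ext f
      have := e.hom.naturality f.op
      simp only [Functor.comp_map, Functor.op_map, Quiver.Hom.unop_op] at this
      simp only [Function.comp_apply, Iso.homCongr_symm, Iso.homCongr_apply, Iso.symm_inv,
        Iso.app_hom, Iso.symm_hom, Iso.app_inv]
      rw [← reassoc_of% this, Iso.hom_inv_id_app]
      exact (Category.comp_id _).symm
    rw [← Function.Bijective.of_comp_iff _
        ((Functor.FullyFaithful.ofFullyFaithful (shiftFunctor C (1 : ℤ))).map_bijective W X), h1,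
      Function.Bijective.of_comp_iff']
    exact (Equiv.bijective _).comp
      ((Functor.FullyFaithful.ofFullyFaithful (shiftFunctor D (-1 : ℤ))).map_bijective _ _)
  refine ⟨fun h W => (key W).1 (h _), fun h W => ?_⟩
  exact bijective_op_map_of_iso ((shiftFunctorCompIsoId C (-1 : ℤ) 1 (by simp)).app W)
    (Iso.refl _) ((key (W⟦(-1 : ℤ)⟧)).2 (h _))

variable [HasZeroObject C] [HasShift C ℤ] [Preadditive C]
  [∀ n : ℤ, (shiftFunctor C n).Additive] [Pretriangulated C]
  [HasZeroObject D] [HasShift D ℤ] [Preadditive D]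
  [∀ n : ℤ, (shiftFunctor D n).Additive] [Pretriangulated D]

/-- A five lemma done by hand: the connecting morphisms of the image triangles are unknown, so
exactness at `F(T.obj₂)` and at `F(T.obj₃)` is read from the images of `T` and of its rotation
separately. -/
lemma FullyFaithfulAt.obj₃ {F : Cᵒᵖ ⥤ D} [F.Additive] (hF : IsWeaklyTriangulated F)
    (hF' : ReversesShift F) {T : Triangle C} (hT : T ∈ distTriang C)
    (h₁ : FullyFaithfulAt F T.obj₁) (h₂ : FullyFaithfulAt F T.obj₂) :
    FullyFaithfulAt F T.obj₃ := by
  intro W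
  have h₁' := (fullyFaithfulAt_shift_iff hF' _).2 h₁ W
  obtain ⟨δ, hδ⟩ := hF T hT
  obtain ⟨δ', hδ'⟩ := hF _ (rot_of_distTriang T hT)
  have hinj {X Y : C} (h : FullyFaithfulAt F Y) (f : X ⟶ Y) (hf : F.map f.op = 0) : f = 0 :=
    (h X).1 (hf.trans (by simp))
  constructor
  · suffices ∀ f : W ⟶ T.obj₃, F.map f.op = 0 → f = 0 by
      intro f g hfg
      refine sub_eq_zero.1 (this _ ?_)
      rw [op_sub, F.map_sub]
      exact sub_eq_zero.2 hfg
    intro f hf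
    -- Faithfulness at `T.obj₁⟦1⟧` kills `f ≫ T.mor₃`, so `f` factors through `T.mor₂`; the factor
    -- `g` is then shown to come from `T.mor₁`.
    obtain ⟨g, rfl⟩ := Triangle.coyoneda_exact₃ T hT f
      (hinj ((fullyFaithfulAt_shift_iff hF' _).2 h₁) _ (by simp [hf]))
    obtain ⟨v, hv⟩ := Triangle.yoneda_exact₂ _ hδ (F.map g.op) (by rwa [op_comp, F.map_comp] at hf)
    obtain ⟨w, rfl⟩ := (h₁ W).2 v
    have : g = w ≫ T.mor₁ := (h₂ W).1 (hv.trans (F.map_comp _ _).symm)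
    simp [this, comp_distTriang_mor_zero₁₂ T hT]
  · intro v
    -- The morphism `a` is the would-be `f ≫ T.mor₃` for a preimage `f` of `v`. A lift `b` of it
    -- gives `v` up to an error coming from `T.obj₂`, which `c` corrects.
    obtain ⟨a, ha⟩ := h₁'.2 (F.map T.mor₃.op ≫ v)
    dsimp at ha
    obtain ⟨b, rfl⟩ := Triangle.coyoneda_exact₁ T hT a
      (hinj ((fullyFaithfulAt_shift_iff hF' _).2 h₂) _ (by
        rw [op_comp, F.map_comp, ha, ← Category.assoc, ← F.map_comp, ← op_comp,
          comp_distTriang_mor_zero₃₁ T hT]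
        simp))
    obtain ⟨w, hw⟩ := Triangle.yoneda_exact₂ _ hδ' (v - F.map b.op) (by
      change F.map T.mor₃.op ≫ _ = 0
      rw [Preadditive.comp_sub, ← ha, op_comp, F.map_comp, sub_self])
    obtain ⟨c, rfl⟩ := (h₂ W).2 w
    refine ⟨b + c ≫ T.mor₂, ?_⟩
    change v - F.map b.op = F.map T.mor₂.op ≫ F.map c.op at hw
    dsimp only
    rw [op_add, F.map_add, op_comp, F.map_comp, ← hw, add_sub_cancel]

lemma FullyFaithfulAt.obj₁ {F : Cᵒᵖ ⥤ D} [F.Additive] (hF : IsWeaklyTriangulated F)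
    (hF' : ReversesShift F) {T : Triangle C} (hT : T ∈ distTriang C)
    (h₂ : FullyFaithfulAt F T.obj₂) (h₃ : FullyFaithfulAt F T.obj₃) :
    FullyFaithfulAt F T.obj₁ :=
  (fullyFaithfulAt_shift_iff hF' _).1 (obj₃ hF hF' (rot_of_distTriang T hT) h₂ h₃)

lemma FullyFaithfulAt.obj₂ {F : Cᵒᵖ ⥤ D} [F.Additive] (hF : IsWeaklyTriangulated F)
    (hF' : ReversesShift F) {T : Triangle C} (hT : T ∈ distTriang C)
    (h₁ : FullyFaithfulAt F T.obj₁) (h₃ : FullyFaithfulAt F T.obj₃) :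
    FullyFaithfulAt F T.obj₂ :=
  obj₁ hF hF' (rot_of_distTriang T hT) h₃ ((fullyFaithfulAt_shift_iff hF' _).2 h₁)

end FullyFaithfulAt

/-! ### Reflexive objects and cohomology in short exact sequences. -/

namespace RightAdjointPair.DerivedSetting

universe v₁ u₁ v₂ u₂

variable {A : Type u₁} [Category.{v₁} A] [Abelian A]
    {B : Type u₂} [Category.{v₂} B] [Abelian B] {p : RightAdjointPair A B} (S : p.DerivedSetting)

/-- The derived functors are Kan extensions, so their additivity is drawn from the derived
adjunction: a right adjoint preserves products. -/
instance : S.RΨ.Additive := by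
  have := S.derivedAdj.isRightAdjoint
  have : PreservesLimitsOfSize.{0, 0} S.RΨ := S.derivedAdj.rightAdjoint_preservesLimits
  exact Functor.additive_of_preserves_binary_products _

instance : S.RΦ.Additive := by
  have := S.derivedAdj.left_adjoint_additive
  exact ⟨fun {X Y f g} => congrArg Quiver.Hom.unop
    (S.RΦ.rightOp.map_add (f := f.unop) (g := g.unop))⟩

lemma isReflexive_iff (X : DerCat S.star A) : S.IsReflexive X ↔ FullyFaithfulAt S.RΦ X :=
  isIso_unit_app_iff_fullyFaithfulAt S.derivedAdj X

lemma isWeaklyTriangulated_RΦ : IsWeaklyTriangulated S.RΦ :=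
  isWeaklyTriangulated_rightDerived S.mapsΦ S.adaptedΦ

lemma reversesShift_RΦ : ReversesShift S.RΦ :=
  reversesShift_rightDerived S.mapsΦ S.adaptedΦ

variable {S} {X : ShortComplex A}

lemma IsReflexiveObj.of_iso {M N : A} (h : S.IsReflexiveObj M) (e : M ≅ N) : S.IsReflexiveObj N :=
  (S.isReflexive_iff _).2 (((S.isReflexive_iff _).1 h).of_iso ((stalk S.star A).mapIso e))

lemma IsReflexiveObj.X₁ (hX : X.ShortExact) (h₂ : S.IsReflexiveObj X.X₂)
    (h₃ : S.IsReflexiveObj X.X₃) : S.IsReflexiveObj X.X₁ := by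
  obtain ⟨δ, hδ⟩ := exists_distinguished_of_shortExact (s := S.star) hX
  exact (S.isReflexive_iff _).2 (FullyFaithfulAt.obj₁ S.isWeaklyTriangulated_RΦ S.reversesShift_RΦ hδ
    ((S.isReflexive_iff _).1 h₂) ((S.isReflexive_iff _).1 h₃))

lemma IsReflexiveObj.X₂ (hX : X.ShortExact) (h₁ : S.IsReflexiveObj X.X₁)
    (h₃ : S.IsReflexiveObj X.X₃) : S.IsReflexiveObj X.X₂ := by
  obtain ⟨δ, hδ⟩ := exists_distinguished_of_shortExact (s := S.star) hX
  exact (S.isReflexive_iff _).2 (FullyFaithfulAt.obj₂ S.isWeaklyTriangulated_RΦ S.reversesShift_RΦ hδ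
    ((S.isReflexive_iff _).1 h₁) ((S.isReflexive_iff _).1 h₃))

lemma IsReflexiveObj.X₃ (hX : X.ShortExact) (h₁ : S.IsReflexiveObj X.X₁)
    (h₂ : S.IsReflexiveObj X.X₂) : S.IsReflexiveObj X.X₃ := by
  obtain ⟨δ, hδ⟩ := exists_distinguished_of_shortExact (s := S.star) hX
  exact (S.isReflexive_iff _).2 (FullyFaithfulAt.obj₃ S.isWeaklyTriangulated_RΦ S.reversesShift_RΦ hδ
    ((S.isReflexive_iff _).1 h₁) ((S.isReflexive_iff _).1 h₂))

/-- This is the exact piece `H^i(RΦ X₂) ⟶ H^i(RΦ X₁) ⟶ H^{i+1}(RΦ X₃)`. -/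
lemma isZero_HΦ_of_shortExact (hX : X.ShortExact) (i : ℤ) (h₂ : IsZero (S.HΦ i X.X₂))
    (h₃ : IsZero (S.HΦ (i + 1) X.X₃)) : IsZero (S.HΦ i X.X₁) := by
  obtain ⟨δ, hδ⟩ := exists_distinguished_of_shortExact (s := S.star) hX
  obtain ⟨δ', hδ'⟩ := S.isWeaklyTriangulated_RΦ _ hδ
  have := (cohomology S.dagger B i).map_distinguished_exact _ (rot_of_distTriang _ hδ')
  exact this.isZero_of_both_zeros (h₂.eq_of_src _ _)
    (((isZero_cohomology_shift_iff (S.RΦ.obj (op ((stalk S.star A).obj X.X₃)))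
      (add_comm 1 i)).2 h₃).eq_of_tgt _ _)

end RightAdjointPair.DerivedSetting

/-! ### Left exact contravariant functors on complexes in nonpositive degrees. -/

section LeftExact

variable {A B : Type*} [Category* A] [Category* B] [Abelian A] [Abelian B]

lemma isIso_homologyFunctor_map_quotient_iff {K L : CochainComplex A ℤ} (f : K ⟶ L) (i : ℤ) :
    IsIso ((HomotopyCategory.homologyFunctor A (ComplexShape.up ℤ) i).map
      ((HomotopyCategory.quotient A (ComplexShape.up ℤ)).map f)) ↔ QuasiIsoAt f i :=
  ((MorphismProperty.isomorphisms A).arrow_mk_iso_iff (((Functor.mapArrowFunctor _ _).mapIso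
    (HomotopyCategory.homologyFunctorFactors A (ComplexShape.up ℤ) i)).app (Arrow.mk f))).trans
    (quasiIsoAt_iff_isIso_homologyMap f i).symm

variable (F : Aᵒᵖ ⥤ B) [F.Additive]

lemma exactAt_mapComplex (K : CochainComplex A ℤ) [K.IsStrictlyLE 0] (i : ℤ) (hi : i < 0) :
    ((mapComplex F).obj (op K)).ExactAt i := by
  have : IsZero (((mapComplex F).obj (op K)).X i) :=
    F.map_isZero ((K.isZero_of_isStrictlyLE 0 (-i) (by lia)).op)
  rw [HomologicalComplex.exactAt_iff]
  exact ShortComplex.exact_of_isZero_X₂ _ this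

variable [PreservesFiniteLimits F]

/-- For `K` in nonpositive degrees, `H^0(K)` is the cokernel of `K^{-1} ⟶ K^0`; left exactness turns
it into the kernel computing `H^0(F K)`. -/
lemma quasiIsoAt_mapComplex {K L : CochainComplex A ℤ} [K.IsStrictlyLE 0] [L.IsStrictlyLE 0]
    (f : K ⟶ L) [QuasiIsoAt f 0] : QuasiIsoAt ((mapComplex F).map f.op) 0 := by
  have hf : QuasiIsoAt f (-0) := by simpa
  rw [quasiIsoAt_iff' _ (-1) (-0) (-(-1)) (by simp) (by simp)] at hf
  rw [quasiIsoAt_iff' _ (-1) 0 1 (by simp) (by simp)]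
  let φ := (HomologicalComplex.shortComplexFunctor' A (ComplexShape.up ℤ) (-1) (-0) (-(-1))).map f
  have hφ : ShortComplex.QuasiIso (ShortComplex.opMap φ) := ShortComplex.quasiIso_opMap φ
  have h (M : CochainComplex A ℤ) [M.IsStrictlyLE 0] :
      F.PreservesLeftHomologyOf (((HomologicalComplex.shortComplexFunctor' A (ComplexShape.up ℤ)
        (-1) (-0) (-(-1))).obj M).op) := ⟨fun h =>
    { g := inferInstance
      -- The source of `f'` is the zero object `K^1`, so its cokernel is preserved although `F` need
      -- not be right exact.
      f' := by
        refine preservesCokernel_zero' F h.f' (IsZero.eq_of_src ?_ _ _)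
        exact (M.isZero_of_isStrictlyLE 0 (-(-1)) (by lia)).op }⟩
  have := h K
  have := h L
  exact ShortComplex.quasiIso_map_of_preservesLeftHomology F (ShortComplex.opMap φ)

end LeftExact

/-! ### Truncation of resolutions of stalk complexes. -/

section Truncation

variable {A : Type*} [Category* A] [Abelian A]

lemma Boundedness.Holds.truncLE {s : Boundedness} {K : CochainComplex A ℤ} (hK : s.Holds K) (n : ℤ) :
    s.Holds (K.truncLE n) := by
  have hGE : (∃ m : ℤ, K.IsStrictlyGE m) → ∃ m : ℤ, (K.truncLE n).IsStrictlyGE m :=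
    fun ⟨m, _⟩ => ⟨m, inferInstance⟩
  have hLE : ∃ m : ℤ, (K.truncLE n).IsStrictlyLE m := ⟨n, inferInstance⟩
  cases s with
  | none => trivial
  | plus => exact hGE hK
  | minus => exact hLE
  | bounded => exact ⟨hGE hK.1, hLE⟩

/-- A complex quasi-isomorphic to an object admits a quasi-isomorphism from a complex concentrated
in nonpositive degrees. -/
lemma exists_qis_isStrictlyLE {s : Boundedness} {X : HoCat s A} {M : A}
    (p : X ⟶ (stalkK s A).obj M) (hp : qis s A p) :
    ∃ (Y : HoCat s A) (f : Y ⟶ X), CochainComplex.IsStrictlyLE Y.obj.as 0 ∧ qis s A f := by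
  obtain ⟨g, hg⟩ := (HomotopyCategory.quotient _ _).map_surjective p.hom
  have hg' : QuasiIso g := (HomotopyCategory.quotient_map_mem_quasiIso_iff g).1 (by rw [hg]; exact hp)
  let K : CochainComplex A ℤ := X.obj.as
  -- The cohomology of `K` is that of a stalk, so its truncation to degrees `≤ 0` is
  -- quasi-isomorphic to it.
  have : K.IsLE 0 := by
    rw [CochainComplex.isLE_iff]
    intro i hi
    refine ((quasiIsoAt_iff_exactAt' g i ?_).1 inferInstance)
    exact ((CochainComplex.singleFunctor A 0).obj M).exactAt_of_isLE 0 i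
  let Y : HoCat s A := ⟨(HomotopyCategory.quotient _ _).obj (K.truncLE 0),
    Boundedness.Holds.truncLE (s := s) (K := K) X.2 0⟩
  let f : Y ⟶ X := (s.prop A).homMk ((HomotopyCategory.quotient _ _).map (K.ιTruncLE 0))
  refine ⟨Y, f, inferInstanceAs ((K.truncLE 0).IsStrictlyLE 0), ?_⟩
  have hq : QuasiIso (K.ιTruncLE 0) := inferInstance
  exact (HomotopyCategory.quotient_map_mem_quasiIso_iff _).2 hq

end Truncation

/-! ### Comparison of a functor with its derived functor on stalk complexes. -/

section Derived

variable {A B : Type*} [Category* A] [Category* B] [Abelian A] [Abelian B]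
  {F : Aᵒᵖ ⥤ B} [F.Additive] {s t : Boundedness}
  (h : ∀ X, s.prop A X → t.prop B ((mapK F).obj (op X)))
  {P : ObjectProperty (HoCat s A)} (hP : IsAdapted F s P)

/-- In the naturality square of the unit at `f`, the unit at `Y` and the derived functor's value on
`f` are invertible. -/
lemma isIso_map_rightDerivedUnit_app_iff {X Y : HoCat s A} (f : Y ⟶ X) (hY : P Y) (hf : qis s A f)
    {H : Type*} [Category* H] (G : DerCat t B ⥤ H) :
    IsIso (G.map ((rightDerivedUnit F h hP).app (op X))) ↔
      IsIso (G.map ((toDer t B).map ((mapBounded F h).map f.op))) := by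
  have h1 := (rightDerivedUnit F h hP).naturality f.op
  have := isIso_rightDerivedUnit_app F h hP Y hY
  have := Localization.inverts (toDer s A) (qis s A) f hf
  have : IsIso ((rightDerived F h hP).map ((toDer s A).map f).op) := inferInstance
  have h2 := congrArg G.map h1
  rw [G.map_comp, G.map_comp] at h2
  constructor
  · intro h3
    have h4 := IsIso.comp_isIso' h3
      (inferInstance : IsIso (G.map ((rightDerived F h hP).map ((toDer s A).map f).op)))
    change IsIso (_ ≫ G.map (((toDer s A).op ⋙ rightDerived F h hP).map f.op)) at h4
    rw [← h2] at h4
    exact (isIso_comp_right_iff _ (G.map ((rightDerivedUnit F h hP).app (op Y)))).1 h4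
  · intro h3
    change IsIso (G.map ((mapBounded F h ⋙ toDer t B).map f.op)) at h3
    have h4 := IsIso.comp_isIso' h3
      (inferInstance : IsIso (G.map ((rightDerivedUnit F h hP).app (op Y))))
    rw [h2] at h4
    exact (isIso_comp_right_iff _
      (G.map ((rightDerived F h hP).map ((toDer s A).map f).op))).1 h4

/-- Part of the two-out-of-six property. -/
lemma isIso_of_isIso_comp_of_isIso_comp {C : Type*} [Category* C] {X Y Z W : C} (a : X ⟶ Y)
    (b : Y ⟶ Z) (c : Z ⟶ W) [IsIso (a ≫ b)] [IsIso (b ≫ c)] : IsIso a := by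
  have : Mono b := mono_of_mono b c
  have : IsSplitEpi b := ⟨⟨inv (a ≫ b) ≫ a, by simp⟩⟩
  have : IsIso b := isIso_of_mono_of_isSplitEpi b
  exact IsIso.of_isIso_comp_right a b

include hP in
/-- A resolution of `M` by a complex of `P`, with the exactness properties needed to compute its
image by `F` in nonpositive degrees. -/
lemma IsAdapted.exists_stalk_resolution (M : A) :
    ∃ (Y T Z : HoCat s A) (f : Y ⟶ (stalkK s A).obj M) (g : T ⟶ Y) (k : Z ⟶ T), P Y ∧ P Z ∧
      CochainComplex.IsStrictlyLE T.obj.as 0 ∧ qis s A f ∧ qis s A g ∧ qis s A k := by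
  obtain ⟨Y, f, hY, hf⟩ := hP.exists_resolution ((stalkK s A).obj M)
  obtain ⟨T, g, hT, hg⟩ := exists_qis_isStrictlyLE f hf
  obtain ⟨Z, k, hZ, hk⟩ := hP.exists_resolution T
  exact ⟨Y, T, Z, f, g, k, hY, hZ, hT, hf, hg, hk⟩

/-- The isomorphism `H^i(F Y) ⟶ H^i(F Z)` between resolutions in `P` factors through `H^i(F T)`,
which vanishes because `F T` lives in nonnegative degrees. -/
lemma isZero_cohomology_rightDerived_stalk (M : A) (i : ℤ) (hi : i < 0) :
    IsZero ((cohomology t B i).obj ((rightDerived F h hP).obj (op ((stalk s A).obj M)))) := by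
  obtain ⟨Y, T, Z, f, g, k, hY, hZ, hT, hf, hg, hk⟩ := hP.exists_stalk_resolution M
  have h1 := hP.isIso_map h (k ≫ g) hZ hY ((qis s A).comp_mem _ _ hk hg)
  have h2 : IsZero ((cohomology t B i).obj ((toDer t B).obj ((mapBounded F h).obj (op T)))) :=
    (isZero_cohomology_toDer_iff _ _).2 (exactAt_mapComplex F T.obj.as i hi)
  have h3 : (cohomology t B i).map ((mapBounded F h ⋙ toDer t B).map (k ≫ g).op) = 0 := by
    rw [op_comp, Functor.map_comp, Functor.map_comp]
    exact (congrArg (_ ≫ ·) (h2.eq_of_src _ 0)).trans comp_zero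
  have h4 : IsZero ((cohomology t B i).obj ((mapBounded F h ⋙ toDer t B).obj (op Y))) := by
    rw [IsZero.iff_id_eq_zero, ← cancel_mono ((cohomology t B i).map
      ((mapBounded F h ⋙ toDer t B).map (k ≫ g).op)), h3]
    simp
  have := isIso_rightDerivedUnit_app F h hP Y hY
  have := Localization.inverts (toDer s A) (qis s A) f hf
  exact IsZero.of_iso h4 ((cohomology t B i).mapIso
    ((rightDerived F h hP).mapIso (asIso ((toDer s A).map f)).op ≪≫
      (asIso ((rightDerivedUnit F h hP).app (op Y))).symm))

/-- A resolution in `P` need not live in nonpositive degrees, and its truncation `T` need not lie in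
`P`. Two out of six on `F M ⟶ F Y ⟶ F T ⟶ F Z` bridges this: on `H^0`, `F Y ⟶ F Z` is invertible as
both ends are in `P`, and `F M ⟶ F T` by left exactness. -/
lemma isIso_cohomology_rightDerivedUnit_stalk [PreservesFiniteLimits F] (M : A) :
    IsIso ((cohomology t B 0).map ((rightDerivedUnit F h hP).app (op ((stalkK s A).obj M)))) := by
  obtain ⟨Y, T, Z, f, g, k, hY, hZ, hT, hf, hg, hk⟩ := hP.exists_stalk_resolution M
  rw [isIso_map_rightDerivedUnit_app_iff h hP f hY hf]
  let G := mapBounded F h ⋙ toDer t B ⋙ cohomology t B 0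
  change IsIso (G.map f.op)
  have h1 : IsIso (G.map g.op ≫ G.map k.op) := by
    rw [← G.map_comp, ← op_comp]
    have := hP.isIso_map h (k ≫ g) hZ hY ((qis s A).comp_mem _ _ hk hg)
    exact (cohomology t B 0).map_isIso ((mapBounded F h ⋙ toDer t B).map (k ≫ g).op)
  have h2 : IsIso (G.map f.op ≫ G.map g.op) := by
    rw [← G.map_comp, ← op_comp]
    obtain ⟨φ, hφ⟩ := (HomotopyCategory.quotient _ _).map_surjective (g ≫ f).hom
    have hφ' : QuasiIso φ := (HomotopyCategory.quotient_map_mem_quasiIso_iff φ).1 (by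
      rw [hφ]; exact (qis s A).comp_mem _ _ hg hf)
    have : CochainComplex.IsStrictlyLE ((stalkK s A).obj M).obj.as 0 :=
      inferInstanceAs (((CochainComplex.singleFunctor A 0).obj M).IsStrictlyLE 0)
    refine (isIso_cohomology_map_toDer_iff ((mapBounded F h).map (g ≫ f).op) 0).2 ?_
    change IsIso ((HomotopyCategory.homologyFunctor B (ComplexShape.up ℤ) 0).map
      ((mapK F).map (g ≫ f).hom.op))
    rw [← hφ]
    exact (isIso_homologyFunctor_map_quotient_iff ((mapComplex F).map φ.op) 0).2
      (quasiIsoAt_mapComplex F φ)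
  exact isIso_of_isIso_comp_of_isIso_comp (G.map f.op) (G.map g.op) (G.map k.op)

/-- The stalk complex of a projective is K-projective, so its map to the exact cone of `f` is zero
and the identity lifts. -/
lemma exists_section_of_projective (M : A) [Projective M] {Y : HoCat s A}
    (f : Y ⟶ (stalkK s A).obj M) (hf : qis s A f) : ∃ g, g ≫ f = 𝟙 ((stalkK s A).obj M) := by
  rw [qis_eq, ObjectProperty.trW_iff] at hf
  obtain ⟨Z, a, b, hT, hZ⟩ := hf
  let K := (CochainComplex.singleFunctor A 0).obj M
  have (n : ℤ) : Projective (K.X n) := by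
    by_cases hn : n = 0
    · subst hn
      exact Projective.of_iso (HomologicalComplex.singleObjXSelf (ComplexShape.up ℤ) 0 M).symm
        inferInstance
    · exact (HomologicalComplex.isZero_single_obj_X (ComplexShape.up ℤ) 0 M n hn).projective
  have : K.IsKProjective := CochainComplex.isKProjective_of_projective K 0
  have ha : a = 0 := by
    ext
    exact CochainComplex.IsKProjective.leftOrthogonal K a.hom hZ
  obtain ⟨g, hg⟩ := Triangle.coyoneda_exact₂ _ hT (𝟙 ((stalkK s A).obj M))
    ((Category.id_comp _).trans ha)
  exact ⟨g, hg.symm⟩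

/-- The section makes the unit at `M` a retract of the unit at a resolution in `P`. -/
lemma isIso_rightDerivedUnit_stalk_of_projective (M : A) [Projective M] :
    IsIso ((rightDerivedUnit F h hP).app (op ((stalkK s A).obj M))) := by
  obtain ⟨Y, f, hY, hf⟩ := hP.exists_resolution ((stalkK s A).obj M)
  obtain ⟨g, hg⟩ := exists_section_of_projective M f hf
  have := isIso_rightDerivedUnit_app F h hP Y hY
  let u := rightDerivedUnit F h hP
  let Φ := mapBounded F h ⋙ toDer t B
  let R := (toDer s A).op ⋙ rightDerived F h hP
  have hg' : f.op ≫ g.op = 𝟙 _ := congrArg Quiver.Hom.op hg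
  have h1 : Φ.map f.op ≫ Φ.map g.op = 𝟙 _ := by rw [← Φ.map_comp, hg', Φ.map_id]
  have h2 : R.map f.op ≫ R.map g.op = 𝟙 _ := by rw [← R.map_comp, hg', R.map_id]
  refine ⟨R.map f.op ≫ inv (u.app (op Y)) ≫ Φ.map g.op, ?_, ?_⟩
  · have := u.naturality f.op
    rw [← Category.assoc]
    refine (congrArg (· ≫ _) this.symm).trans ?_
    rw [Category.assoc, IsIso.hom_inv_id_assoc]
    exact h1
  · have := u.naturality g.op
    rw [Category.assoc, Category.assoc]
    refine (congrArg (fun x => R.map f.op ≫ inv (u.app (op Y)) ≫ x) this).trans ?_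
    rw [IsIso.inv_hom_id_assoc]
    exact h2

end Derived

/-! ### Acyclic objects and the comparison morphism. -/

section Stalk

variable {A B : Type*} [Category* A] [Category* B] [Abelian A] [Abelian B]

lemma quasiIsoAt_zero_iff_isIso_f {K L : CochainComplex A ℤ} (f : K ⟶ L) [K.IsStrictlyGE 0]
    [K.IsStrictlyLE 0] [L.IsStrictlyGE 0] [L.IsStrictlyLE 0] :
    QuasiIsoAt f 0 ↔ IsIso (f.f 0) := by
  have hK₁ : K.d (-1) 0 = 0 := (K.isZero_of_isStrictlyGE 0 (-1)).eq_of_src _ _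
  have hK₂ : K.d 0 1 = 0 := (K.isZero_of_isStrictlyLE 0 1).eq_of_tgt _ _
  have hL₁ : L.d (-1) 0 = 0 := (L.isZero_of_isStrictlyGE 0 (-1)).eq_of_src _ _
  have hL₂ : L.d 0 1 = 0 := (L.isZero_of_isStrictlyLE 0 1).eq_of_tgt _ _
  rw [quasiIsoAt_iff' f (-1) 0 1 (by simp) (by simp),
    ShortComplex.quasiIso_iff_of_zeros _ hK₁ hK₂ hL₁, ShortComplex.exact_iff_epi _ hL₂]
  change Epi (f.f 0) ∧ Mono (f.f 0) ↔ _
  exact ⟨fun ⟨_, _⟩ => isIso_of_mono_of_epi _, fun _ => ⟨inferInstance, inferInstance⟩⟩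

variable (s : Boundedness) in
lemma isZero_cohomology_stalk (M : A) (i : ℤ) (hi : i ≠ 0) :
    IsZero ((cohomology s A i).obj ((stalk s A).obj M)) := by
  let K := (CochainComplex.singleFunctor A 0).obj M
  refine (isZero_cohomology_toDer_iff ((stalkK s A).obj M) i).2 ?_
  change K.ExactAt i
  rcases lt_or_gt_of_ne hi with h | h
  · exact K.exactAt_of_isGE 0 i
  · exact K.exactAt_of_isLE 0 i

variable (F : Aᵒᵖ ⥤ B) [F.Additive] {s t : Boundedness}
  (h : ∀ X, s.prop A X → t.prop B ((mapK F).obj (op X)))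

/-- The termwise extension of `F` maps the stalk complex of `M` to that of `F(M)`. -/
lemma nonempty_mapBounded_stalkK_iso (M : A) :
    Nonempty ((mapBounded F h).obj (op ((stalkK s A).obj M)) ≅ (stalkK t B).obj (F.obj (op M))) := by
  let K := (mapComplex F).obj (op ((CochainComplex.singleFunctor A 0).obj M))
  have hK (i : ℤ) (hi : i ≠ 0) : IsZero (K.X i) :=
    F.map_isZero (HomologicalComplex.isZero_single_obj_X (ComplexShape.up ℤ) 0 M (-i) (by lia)).op
  have : K.IsStrictlyGE 0 := (K.isStrictlyGE_iff 0).2 fun i hi => hK i (by lia)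
  have : K.IsStrictlyLE 0 := (K.isStrictlyLE_iff 0).2 fun i hi => hK i (by lia)
  obtain ⟨N, ⟨e⟩⟩ := CochainComplex.exists_iso_single K 0
  let e₀ : N ≅ F.obj (op M) :=
    (HomologicalComplex.singleObjXSelf (ComplexShape.up ℤ) 0 N).symm ≪≫
      ((HomologicalComplex.eval B (ComplexShape.up ℤ) 0).mapIso e).symm ≪≫
      F.mapIso (HomologicalComplex.singleObjXSelf (ComplexShape.up ℤ) 0 M).symm.op
  exact ⟨ObjectProperty.isoMk _ ((HomotopyCategory.quotient _ _).mapIso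
    (e ≪≫ (CochainComplex.singleFunctor B 0).mapIso e₀))⟩

variable {F} {P : ObjectProperty (HoCat s A)} (hP : IsAdapted F s P)

lemma isZero_cohomology_mapBounded_stalkK (M : A) (i : ℤ) (hi : i ≠ 0) :
    IsZero ((cohomology t B i).obj
      ((mapBounded F h ⋙ toDer t B).obj (op ((stalkK s A).obj M)))) := by
  obtain ⟨e⟩ := nonempty_mapBounded_stalkK_iso F h M
  exact (isZero_cohomology_stalk t (F.obj (op M)) i hi).of_iso
    ((cohomology t B i).mapIso ((toDer t B).mapIso e))

/-- The comparison is always invertible on `H^0`, and `F M` has no cohomology elsewhere. -/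
lemma isIso_rightDerivedUnit_stalk_iff [PreservesFiniteLimits F] (M : A) :
    IsIso ((rightDerivedUnit F h hP).app (op ((stalkK s A).obj M))) ↔
      ∀ i : ℤ, i ≠ 0 →
        IsZero ((cohomology t B i).obj ((rightDerived F h hP).obj (op ((stalk s A).obj M)))) := by
  refine ⟨fun _ i hi => (isZero_cohomology_mapBounded_stalkK h M i hi).of_iso
    ((cohomology t B i).mapIso
      (asIso ((rightDerivedUnit F h hP).app (op ((stalkK s A).obj M))))).symm, fun hM => ?_⟩
  refine isIso_of_cohomology _ fun i => ?_
  by_cases hi : i = 0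
  · subst hi
    exact isIso_cohomology_rightDerivedUnit_stalk h hP M
  · exact (isZero_cohomology_mapBounded_stalkK h M i hi).isIso (hM i hi) _

end Stalk

/-! ### Reflexivity of `Φ`-acyclic objects. -/

namespace RightAdjointPair

universe v₁ u₁ v₂ u₂

variable {A : Type u₁} [Category.{v₁} A] [Abelian A]
    {B : Type u₂} [Category.{v₂} B] [Abelian B] (p : RightAdjointPair A B)

instance : PreservesFiniteLimits p.Ψ := by
  have : PreservesLimitsOfSize.{0, 0} p.Ψ := p.adj.rightAdjoint_preservesLimits
  exact PreservesLimitsOfSize.preservesFiniteLimits p.Ψ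

instance : PreservesFiniteLimits p.Φ := by
  have : PreservesColimitsOfSize.{0, 0} p.Φ.rightOp := p.adj.leftAdjoint_preservesColimits
  have := PreservesColimitsOfSize.preservesFiniteColimits p.Φ.rightOp
  exact preservesFiniteLimits_of_rightOp p.Φ

namespace DerivedSetting

variable {p} (S : p.DerivedSetting)

lemma isIso_α_app_stalkK_iff (M : A) :
    IsIso (S.α.app ((stalkK S.star A).obj M)) ↔ S.IsΦAcyclic M := by
  refine Iff.trans ?_ (isIso_rightDerivedUnit_stalk_iff S.mapsΦ S.adaptedΦ M)
  exact isIso_op_iff ((rightDerivedUnit p.Φ S.mapsΦ S.adaptedΦ).app _)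

lemma isΦAcyclic_of_projective (M : A) [Projective M] : S.IsΦAcyclic M :=
  (isIso_rightDerivedUnit_stalk_iff S.mapsΦ S.adaptedΦ M).1
    (isIso_rightDerivedUnit_stalk_of_projective S.mapsΦ S.adaptedΦ M)

lemma isZero_HΦ_of_neg (M : A) (i : ℤ) (hi : i < 0) : IsZero (S.HΦ i M) :=
  isZero_cohomology_rightDerived_stalk S.mapsΦ S.adaptedΦ M i hi

lemma adjBounded_unit_app_hom (X : HoCat S.star A) :
    (S.adjBounded.unit.app X).hom = p.adjK.unit.app X.obj := by
  have h := Adjunction.map_restrictFullyFaithful_unit_app p.adjK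
      (ObjectProperty.fullyFaithfulι (S.star.prop A))
      (ObjectProperty.fullyFaithfulι (S.dagger.prop B)).op
      (L := (mapBounded p.Φ S.mapsΦ).rightOp) (R := mapBounded p.Ψ S.mapsΨ)
      (Iso.refl _) (Iso.refl _) X
  have h' : (mapK p.Ψ).map (𝟙 (op ((mapK p.Φ).obj (op X.obj)))) ≫ 𝟙 _ = 𝟙 _ :=
    (Category.comp_id _).trans ((mapK p.Ψ).map_id _)
  exact h.trans ((congrArg (p.adjK.unit.app X.obj ≫ ·) h').trans (Category.comp_id _))

lemma adjK_unit_app (K : CochainComplex A ℤ) :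
    p.adjK.unit.app ((HomotopyCategory.quotient A (ComplexShape.up ℤ)).obj K) =
      (HomotopyCategory.quotient A (ComplexShape.up ℤ)).map (p.unitC K) :=
  rfl

/-- Both complexes are concentrated in degree `0`, where the termwise unit is `η` up to isomorphism.
-/
lemma isIso_cohomology_toDer_unit_iff (M : A) :
    IsIso ((cohomology S.star A 0).map
      ((toDer S.star A).map (S.adjBounded.unit.app ((stalkK S.star A).obj M)))) ↔
      IsIso (p.adj.unit.app M) := by
  rw [isIso_cohomology_map_toDer_iff]
  let K := (CochainComplex.singleFunctor A 0).obj M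
  have hu : (S.adjBounded.unit.app ((stalkK S.star A).obj M)).hom =
      (HomotopyCategory.quotient A (ComplexShape.up ℤ)).map (p.unitC K) :=
    (S.adjBounded_unit_app_hom ((stalkK S.star A).obj M)).trans (adjK_unit_app K)
  rw [hu]
  refine (isIso_homologyFunctor_map_quotient_iff (p.unitC K) 0).trans ?_
  let L := (mapComplex p.Ψ).obj (op ((mapComplex p.Φ).obj (op K)))
  have hL (i : ℤ) (hi : i ≠ 0) : IsZero (L.X i) := by
    refine p.Ψ.map_isZero (IsZero.op (p.Φ.map_isZero (IsZero.op ?_)))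
    exact HomologicalComplex.isZero_single_obj_X (ComplexShape.up ℤ) 0 M (- -i) (by lia)
  have : L.IsStrictlyGE 0 := (L.isStrictlyGE_iff 0).2 fun i hi => hL i (by lia)
  have : L.IsStrictlyLE 0 := (L.isStrictlyLE_iff 0).2 fun i hi => hL i (by lia)
  refine (quasiIsoAt_zero_iff_isIso_f (p.unitC K)).trans ?_
  refine (isIso_comp_left_iff (K.XIsoOfEq (neg_neg 0)).inv (p.adj.unit.app (K.X (- -0)))).trans ?_
  exact NatTrans.isIso_app_iff_of_iso p.adj.unit
    (HomologicalComplex.singleObjXSelf (ComplexShape.up ℤ) 0 M)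

/-- A `Φ`-acyclic object is `D`-reflexive if and only if it belongs to `𝒢_{ΦΨ}`. -/
lemma isReflexiveObj_iff_of_isΦAcyclic {M : A} (hM : S.IsΦAcyclic M) :
    S.IsReflexiveObj M ↔ S.G M := by
  let X := (stalkK S.star A).obj M
  let Y := (mapBounded p.Φ S.mapsΦ).obj (op X)
  obtain ⟨e⟩ : Nonempty (Y ≅ (stalkK S.dagger B).obj (p.Φ.obj (op M))) :=
    nonempty_mapBounded_stalkK_iso p.Φ S.mapsΦ M
  have hα : IsIso (S.α.app X) := (S.isIso_α_app_stalkK_iff M).2 hM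
  let H (i : ℤ) := cohomology S.star A i
  have hβ : IsIso ((H 0).map (S.β.app (op Y))) :=
    (NatTrans.isIso_app_iff_of_iso (Functor.whiskerRight S.β (H 0)) e.symm.op).2
      (isIso_cohomology_rightDerivedUnit_stalk S.mapsΨ S.adaptedΨ (p.Φ.obj (op M)))
  let η := (toDer S.star A).map (S.adjBounded.unit.app X)
  let ξ : (toDer S.star A).obj X ⟶ S.RΨ.obj (op ((toDer S.dagger B).obj Y)) :=
    η ≫ S.β.app (op Y)
  -- This compatibility characterizes the derived unit. As `α` is invertible at `X` by acyclicity,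
  -- reflexivity becomes invertibility of `ξ`.
  have hfac : S.derivedAdj.unit.app ((toDer S.star A).obj X) ≫ S.RΨ.map (S.α.app X) = ξ :=
    Adjunction.derivedη_fac_app S.adjBounded (qis S.star A) S.α S.β X
  have h₁ : S.IsReflexiveObj M ↔ IsIso ξ := by
    rw [← hfac, isIso_comp_right_iff]
    rfl
  let eΨ : S.RΨ.obj (op ((toDer S.dagger B).obj Y)) ≅
      S.RΨ.obj (op ((stalk S.dagger B).obj (p.Φ.obj (op M)))) :=
    S.RΨ.mapIso ((toDer S.dagger B).mapIso e).symm.op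
  have h₂ : IsIso ((H 0).map ξ) ↔ IsIso (p.adj.unit.app M) := by
    rw [← S.isIso_cohomology_toDer_unit_iff M, (H 0).map_comp]
    exact isIso_comp_right_iff _ _
  rw [h₁]
  constructor
  · intro hξ
    refine ⟨hM, fun i hi => ?_, h₂.1 inferInstance⟩
    exact (isZero_cohomology_stalk S.star M i hi).of_iso ((H i).mapIso (asIso ξ ≪≫ eΨ)).symm
  · rintro ⟨-, hΨ, hη⟩
    refine isIso_of_cohomology _ fun i => ?_
    by_cases hi : i = 0
    · subst hi
      exact h₂.2 hη
    · exact (isZero_cohomology_stalk S.star M i hi).isIso ((hΨ i hi).of_iso ((H i).mapIso eΨ)) _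

end DerivedSetting

end RightAdjointPair

/-! ### Splicing and truncating left resolutions. -/

section Resolution

variable {A : Type*} [Category* A] [Abelian A]

/-- Exactness is unchanged when the first morphism is precomposed with an epimorphism and the
second one is postcomposed with a monomorphism. -/
lemma exact_iff_of_epi_of_mono {X' X Y Z Z' : A} {f : X ⟶ Y} {g : Y ⟶ Z} (a : X' ⟶ X) [Epi a]
    (b : Z ⟶ Z') [Mono b] {f' : X' ⟶ Y} {g' : Y ⟶ Z'} (hf : a ≫ f = f') (hg : g ≫ b = g')
    (w : f ≫ g = 0) (w' : f' ≫ g' = 0) :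
    (ShortComplex.mk f' g' w').Exact ↔ (ShortComplex.mk f g w).Exact := by
  subst hf hg
  have w'' : f ≫ g ≫ b = 0 := by rw [reassoc_of% w, zero_comp]
  let φ : ShortComplex.mk (a ≫ f) (g ≫ b) w' ⟶ ShortComplex.mk f (g ≫ b) w'' :=
    { τ₁ := a, τ₂ := 𝟙 _, τ₃ := 𝟙 _ }
  let ψ : ShortComplex.mk f g w ⟶ ShortComplex.mk f (g ≫ b) w'' :=
    { τ₁ := 𝟙 _, τ₂ := 𝟙 _, τ₃ := b }
  have : Epi φ.τ₁ := inferInstanceAs (Epi a)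
  have : IsIso φ.τ₂ := inferInstanceAs (IsIso (𝟙 _))
  have : Mono φ.τ₃ := inferInstanceAs (Mono (𝟙 _))
  have : Epi ψ.τ₁ := inferInstanceAs (Epi (𝟙 _))
  have : IsIso ψ.τ₂ := inferInstanceAs (IsIso (𝟙 _))
  have : Mono ψ.τ₃ := inferInstanceAs (Mono b)
  rw [ShortComplex.exact_iff_of_epi_of_isIso_of_mono φ,
    ShortComplex.exact_iff_of_epi_of_isIso_of_mono ψ]

lemma exactAt_succ_iff (C : ChainComplex A ℕ) (i : ℕ) : C.ExactAt (i + 1) ↔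
    (ShortComplex.mk (C.d (i + 2) (i + 1)) (C.d (i + 1) i) (C.d_comp_d _ _ _)).Exact :=
  C.exactAt_iff' (i + 2) (i + 1) i (by simp) (by simp)

/-- Splicing a resolution of the kernel of `G ⟶ M` with that morphism. -/
lemma exists_resolution_of_shortExact {X : ShortComplex A} (hX : X.ShortExact)
    (C : ChainComplex A ℕ) (ε : C.X 0 ⟶ X.X₁) (w : C.d 1 0 ≫ ε = 0) [Epi ε]
    (h₀ : (ShortComplex.mk _ _ w).Exact) (h : ∀ i, C.ExactAt (i + 1)) :
    ∃ (C' : ChainComplex A ℕ) (ε' : C'.X 0 ⟶ X.X₃) (w' : C'.d 1 0 ≫ ε' = 0),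
      C'.X 0 = X.X₂ ∧ (∀ i, C'.X (i + 1) = C.X i) ∧ Epi ε' ∧ (ShortComplex.mk _ _ w').Exact ∧
        ∀ i, C'.ExactAt (i + 1) := by
  have := hX.mono_f
  have := hX.epi_g
  have wf : C.d 1 0 ≫ ε ≫ X.f = 0 := by rw [reassoc_of% w, zero_comp]
  have wg : (ε ≫ X.f) ≫ X.g = 0 := by rw [Category.assoc, X.zero, comp_zero]
  refine ⟨C.augment (ε ≫ X.f) wf, X.g, wg, rfl, fun _ => rfl, inferInstanceAs (Epi X.g), ?_,
    fun i => ?_⟩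
  · exact (exact_iff_of_epi_of_mono ε (𝟙 _) rfl (Category.comp_id _) X.zero wg).2 hX.exact
  · rw [exactAt_succ_iff]
    cases i with
    | zero => exact (exact_iff_of_epi_of_mono (𝟙 _) X.f (Category.id_comp _) rfl w wf).2 h₀
    | succ i => exact (exactAt_succ_iff C i).1 (h i)

lemma LeftDimLE.of_shortExact {F : ObjectProperty A} {X : ShortComplex A} (hX : X.ShortExact)
    (h₂ : F X.X₂) {n : ℕ} (h₁ : LeftDimLE F X.X₁ n) : LeftDimLE F X.X₃ (n + 1 : ℕ) := by
  obtain ⟨C, ε, w, hF, hn, hε, h₀, h⟩ := h₁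
  obtain ⟨C', ε', w', e₀, e, hε', h₀', h'⟩ := exists_resolution_of_shortExact hX C ε w h₀ h
  refine ⟨C', ε', w', fun i => ?_, fun i hi => ?_, hε', h₀', h'⟩
  · cases i with
    | zero => exact Or.inl (e₀ ▸ h₂)
    | succ i => rw [e]; exact hF i
  · cases i with
    | zero => simp at hi
    | succ i =>
      rw [e]
      exact hn i (by exact_mod_cast Nat.lt_of_succ_lt_succ (by exact_mod_cast hi))

lemma leftDimLE_of_prop {F : ObjectProperty A} {M : A} (hM : F M) : LeftDimLE F M (0 : ℕ) := by
  let X : ShortComplex A := ShortComplex.mk (0 : (0 : A) ⟶ M) (𝟙 M) zero_comp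
  have hX : X.ShortExact :=
    { exact := (ShortComplex.exact_iff_mono _ rfl).2 (inferInstanceAs (Mono (𝟙 M)))
      mono_f := ⟨fun _ _ _ => (isZero_zero A).eq_of_tgt _ _⟩
      epi_g := inferInstanceAs (Epi (𝟙 M)) }
  have h0 (i : ℕ) : IsZero ((0 : ChainComplex A ℕ).X i) :=
    (HomologicalComplex.eval A (ComplexShape.down ℕ) i).map_isZero (isZero_zero _)
  have : Epi (0 : (0 : ChainComplex A ℕ).X 0 ⟶ X.X₁) :=
    ⟨fun _ _ _ => (isZero_zero A).eq_of_src _ _⟩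
  -- The identity of `M` has zero kernel, resolved by the zero complex.
  obtain ⟨C', ε', w', e₀, e, hε', h₀', h'⟩ := exists_resolution_of_shortExact hX 0 0 (by simp)
    (ShortComplex.exact_of_isZero_X₂ _ (h0 0))
    (fun i => (exactAt_succ_iff _ i).2 (ShortComplex.exact_of_isZero_X₂ _ (h0 _)))
  refine ⟨C', ε', w', fun i => ?_, fun i hi => ?_, hε', h₀', h'⟩
  · cases i with
    | zero => exact Or.inl (e₀ ▸ hM)
    | succ i => rw [e]; exact Or.inr (h0 i)
  · cases i with
    | zero => simp at hi
    | succ i => rw [e]; exact h0 i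

lemma d_comp_kernel_lift {C : ChainComplex A ℕ} {M : A} (ε : C.X 0 ⟶ M) (w : C.d 1 0 ≫ ε = 0) :
    C.d 2 1 ≫ kernel.lift ε (C.d 1 0) w = 0 := by
  rw [← cancel_mono (kernel.ι ε), Category.assoc, kernel.lift_ι, zero_comp]
  exact C.d_comp_d 2 1 0

lemma exact_kernel_lift {C : ChainComplex A ℕ} {M : A} (ε : C.X 0 ⟶ M) (w : C.d 1 0 ≫ ε = 0)
    (h : C.ExactAt 1) : (ShortComplex.mk _ _ (d_comp_kernel_lift ε w)).Exact :=
  (exact_iff_of_epi_of_mono (𝟙 _) (kernel.ι ε) (Category.id_comp _) (kernel.lift_ι _ _ _)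
    (d_comp_kernel_lift ε w) (C.d_comp_d 2 1 0)).1 ((exactAt_succ_iff C 0).1 h)

lemma shortExact_kernel {G M : A} (ε : G ⟶ M) [Epi ε] :
    (ShortComplex.mk (kernel.ι ε) ε (kernel.condition ε)).ShortExact :=
  { exact := ShortComplex.exact_kernel ε
    mono_f := inferInstanceAs (Mono (kernel.ι ε))
    epi_g := inferInstanceAs (Epi ε) }

lemma exactAt_truncate_iff (C : ChainComplex A ℕ) (i : ℕ) :
    (ChainComplex.truncate.obj C).ExactAt (i + 1) ↔ C.ExactAt (i + 2) := by
  rw [exactAt_succ_iff, exactAt_succ_iff]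
  rfl

/-- The inverse of splicing: dropping the term in degree `0` leaves a resolution of the first
syzygy. -/
lemma LeftDimLE.exists_epi {F : ObjectProperty A} {M : A} {n : ℕ} (h : LeftDimLE F M (n + 1 : ℕ)) :
    ∃ (G : A) (ε : G ⟶ M), Epi ε ∧ (F G ∨ IsZero G) ∧ LeftDimLE F (kernel ε) n := by
  obtain ⟨C, ε, w, hF, hn, hε, h₀, h⟩ := h
  refine ⟨C.X 0, ε, hε, hF 0, ChainComplex.truncate.obj C, kernel.lift ε (C.d 1 0) w,
    d_comp_kernel_lift ε w, fun i => hF (i + 1), fun i hi => hn (i + 1) ?_,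
    (ShortComplex.exact_iff_epi_kernel_lift _).1 h₀, exact_kernel_lift ε w (h 0),
    fun i => (exactAt_truncate_iff C i).2 (h (i + 1))⟩
  exact_mod_cast Nat.succ_lt_succ (by exact_mod_cast hi)

lemma LeftDimLE.exists_iso {F : ObjectProperty A} {M : A} (h : LeftDimLE F M (0 : ℕ)) :
    ∃ G : A, (F G ∨ IsZero G) ∧ Nonempty (G ≅ M) := by
  obtain ⟨C, ε, w, hF, hn, hε, h₀, h⟩ := h
  have : Mono ε := (ShortComplex.exact_iff_mono _
    ((hn 1 (by simp)).eq_of_src (C.d 1 0) 0)).1 h₀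
  have := isIso_of_mono_of_epi ε
  exact ⟨C.X 0, hF 0, ⟨asIso ε⟩⟩

end Resolution

/-! ### Modules and the two implications. -/

variable {R : Type u} [Ring R]

lemma FP.exists_epi {M : ModuleCat.{w} R} {n : ℕ} (h : FP (n + 1) M) :
    ∃ (P : ModuleCat.{w} R) (ε : P ⟶ M), Epi ε ∧ Module.Finite R P ∧ Module.Projective R P ∧
      FP n (kernel ε) := by
  obtain ⟨C, ε, w, hP, hε, h₀, h⟩ := h
  refine ⟨C.X 0, ε, hε (by lia), (hP 0 (by lia)).1, (hP 0 (by lia)).2,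
    ChainComplex.truncate.obj C, kernel.lift ε (C.d 1 0) w, d_comp_kernel_lift ε w,
    fun i hi => hP (i + 1) (by lia), fun hn => (ShortComplex.exact_iff_epi_kernel_lift _).1 (h₀ (by lia)),
    fun hn => exact_kernel_lift ε w (h 0 (by lia)),
    fun i hi => (exactAt_truncate_iff C i).2 (h (i + 1) (by lia))⟩

namespace RightAdjointPair.DerivedSetting

section

variable {A : Type*} [Category* A] [Abelian A] {B : Type*} [Category* B] [Abelian B]
  {p : RightAdjointPair A B} {S : p.DerivedSetting}

lemma IsReflexiveObj.of_retract {M N : A} (hN : S.IsReflexiveObj N) (r : Retract M N) :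
    S.IsReflexiveObj M :=
  MorphismProperty.of_retract (P := MorphismProperty.isomorphisms _)
    (NatTrans.retractArrowApp S.derivedAdj.unit (r.map (stalk S.star A))) hN

/-- This handles the zero terms that a resolution may contain, without asking whether they lie in
`𝒢_{ΦΨ}`. -/
lemma IsReflexiveObj.of_isZero {M N : A} (hN : S.IsReflexiveObj N) (hM : IsZero M) :
    S.IsReflexiveObj M :=
  hN.of_retract ⟨0, 0, hM.eq_of_src _ _⟩

lemma isReflexiveObj_of_leftDimLE {N : A} (hN : S.IsReflexiveObj N) {n : ℕ} {M : A}
    (h : LeftDimLE S.G M n) : S.IsReflexiveObj M := by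
  have hG {X : A} (hX : S.G X ∨ IsZero X) : S.IsReflexiveObj X :=
    hX.elim (fun h => (S.isReflexiveObj_iff_of_isΦAcyclic h.1).2 h) hN.of_isZero
  induction n generalizing M with
  | zero =>
    obtain ⟨X, hX, ⟨e⟩⟩ := h.exists_iso
    exact (hG hX).of_iso e
  | succ n ih =>
    obtain ⟨X, ε, _, hX, h⟩ := h.exists_epi
    exact IsReflexiveObj.X₃ (shortExact_kernel ε) (ih h) (hG hX)

end

variable {B : Type w} [Category.{v} B] [Abelian B] {p : RightAdjointPair (ModuleCat.{u} R) B}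
  {S : p.DerivedSetting}

lemma isReflexiveObj_pi (hR : S.IsReflexiveObj (ModuleCat.of R R)) (n : ℕ) :
    S.IsReflexiveObj (ModuleCat.of R (Fin n → R)) := by
  induction n with
  | zero => exact hR.of_isZero (ModuleCat.isZero_of_subsingleton _)
  | succ n ih =>
    let X : ShortComplex (ModuleCat.{u} R) :=
      ShortComplex.mk (ModuleCat.ofHom (LinearMap.inl R R (Fin n → R)))
        (ModuleCat.ofHom (LinearMap.snd R R (Fin n → R))) (by
          rw [← ModuleCat.ofHom_comp, LinearMap.snd_comp_inl, ModuleCat.ofHom_zero])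
    have hX : X.ShortExact := ShortComplex.Splitting.shortExact
      { r := ModuleCat.ofHom (LinearMap.fst R R (Fin n → R))
        s := ModuleCat.ofHom (LinearMap.inr R R (Fin n → R))
        f_r := by ext; simp [X]
        s_g := by ext; simp [X]
        id := by ext x <;> simp [X] }
    exact (IsReflexiveObj.X₂ hX hR ih).of_iso
      (Fin.consLinearEquiv R (fun _ : Fin (n + 1) => R)).toModuleIso

lemma isReflexiveObj_of_finite_of_projective (hR : S.IsReflexiveObj (ModuleCat.of R R))
    (P : ModuleCat.{u} R) [Module.Finite R P] [Module.Projective R P] : S.IsReflexiveObj P := by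
  obtain ⟨n, f, hf⟩ := Module.Finite.exists_fin' R P
  obtain ⟨g, hg⟩ := Module.projective_lifting_property f LinearMap.id hf
  exact (isReflexiveObj_pi hR n).of_retract
    ⟨ModuleCat.ofHom g, ModuleCat.ofHom f, by ext x; exact LinearMap.congr_fun hg x⟩

/-- The bound on cohomology is assumed for `M` alone, not for all modules: in this form it drops by
one on passing to a syzygy, so the induction goes through. -/
lemma leftDimLE_of_isReflexiveObj (hR : S.IsReflexiveObj (ModuleCat.of R R)) {n : ℕ}
    {M : ModuleCat.{u} R} (hM : FP n M) (hn : ∀ i : ℤ, n < i → IsZero (S.HΦ i M))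
    (h : S.IsReflexiveObj M) : LeftDimLE S.G M n := by
  induction n generalizing M with
  | zero =>
    -- Negative cohomology vanishes for every module and positive cohomology by the bound, so `M` is
    -- `Φ`-acyclic.
    refine leftDimLE_of_prop ((S.isReflexiveObj_iff_of_isΦAcyclic fun i hi => ?_).1 h)
    rcases lt_or_gt_of_ne hi with hi | hi
    · exact S.isZero_HΦ_of_neg M i hi
    · exact hn i (by exact_mod_cast hi)
  | succ n ih =>
    obtain ⟨P, ε, _, _, _, hK⟩ := hM.exists_epi
    have : Projective P := (IsProjective.iff_projective (R := R) P).1 inferInstance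
    have hP := isReflexiveObj_of_finite_of_projective hR P
    have hP' := S.isΦAcyclic_of_projective P
    refine LeftDimLE.of_shortExact (shortExact_kernel ε)
      ((S.isReflexiveObj_iff_of_isΦAcyclic hP').1 hP) (ih hK (fun i hi => ?_)
        (IsReflexiveObj.X₁ (shortExact_kernel ε) hP h))
    -- From `i > n ≥ 0` follows `i ≠ 0`, so acyclicity of `P` applies, while `i + 1 > n + 1` puts
    -- `H^{i+1}(RΦ M)` beyond the bound.
    exact isZero_HΦ_of_shortExact (shortExact_kernel ε) i (hP' i (by lia))
      (hn (i + 1) (by push_cast; lia))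

end RightAdjointPair.DerivedSetting

end DerivedPair

theorem mainTheorem5 {R : Type u} [Ring R] {B : Type w} [Category.{v} B] [Abelian B]
    (p : DerivedPair.RightAdjointPair (ModuleCat.{u} R) B) (S : p.DerivedSetting) (n : ℕ)
    (hR : S.IsReflexiveObj (ModuleCat.of R R)) (hn : S.CohDimLE n)
    (M : ModuleCat.{u} R) (hM : DerivedPair.FP n M) :
    S.IsReflexiveObj M ↔ DerivedPair.LeftDimLE S.G M n :=
  ⟨DerivedPair.RightAdjointPair.DerivedSetting.leftDimLE_of_isReflexiveObj hR hM
    fun i hi => hn M i (hi.trans_le (le_abs_self i)),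
  DerivedPair.RightAdjointPair.DerivedSetting.isReflexiveObj_of_leftDimLE hR⟩
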